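/- Let $\varepsilon>0$, let $B^d$ be the open unit ball of $\mathbb{R}^d$, let $\mu$ be the uniform probability measure on $B^d$, and let $\nu_1,\nu_2$ be Borel probability measures on $\mathbb{R}^d$ with finite second moment. For a probability measure $\nu$ on $\mathbb{R}^d$ with finite second moment, let $\pi^*_\varepsilon$ be the minimiser of $$\pi\mapsto\int \tfrac12\|u-x\|^2\,d\pi(u,x)+\varepsilon\,\mathrm{KL}(\pi\,|\,\mu\otimes\nu)$$ over all couplings $\pi$ of $\mu$ and $\nu$. The EOT map of $\nu$ is $T^\varepsilon_\nu(u)=E_{\pi^*_\varepsilon}[X\mid U=u]$, where $(U,X)\sim\pi^*_\varepsilon$ (a function defined up to $\mu$-null sets). Let $(\varphi,\psi)\in L^1(\mu)\times L^1(\nu)$ be a maximiser of $$(\varphi,\psi)\mapsto\int\varphi\,d\mu+\int\psi\,d\nu-\varepsilon\int e^{\frac{\varphi(u)+\psi(x)-\frac12\|u-x\|^2}{\varepsilon}}\,d(\mu\otimes\nu)(u,x)+\varepsilon$$ over $L^1(\mu)\times L^1(\nu)$, where $\varphi$ is represented by a function that is continuous on $B^d$. The EOT potential of $\nu$ with base point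 $u_0\in B^d$ is $$\varphi^\varepsilon_\nu(u)=\Big(\tfrac12\|u\|^2-\varphi(u)\Big)-\Big(\tfrac12\|u_0\|^2-\varphi(u_0)\Big),\qquad u\in B^d .$$ The base point is either (a) a fixed point $u_0\in B^d$, the same for all $\nu$, or (b) a minimiser of $u\mapsto \frac12\|u\|^2-\varphi(u)$ over $B^d$ whenever a minimiser exists, and a fixed point $u_0\in B^d$ independent of $\nu$ otherwise. Then: (i) with either choice (a) or (b) of the base points, and for any EOT potentials $\varphi^\varepsilon_{\nu_1}$, $\varphi^\varepsilon_{\nu_2}$ of $\nu_1$, $\nu_2$, one has $\nu_1=\nu_2$ if and only if $\varphi^\varepsilon_{\nu_1}(u)=\varphi^\varepsilon_{\nu_2}(u)$ for $\mu$-almost every $u$; (ii) for any EOT maps $T^\varepsilon_{\nu_1}$, $T^\varepsilon_{\nu_2}$ of $\nu_1$, $\nu_2$, one has $\nu_1=\nu_2$ if and only if $T^\varepsilon_{\nu_1}(u)=T^\varepsilon_{\nu_2}(u)$ for $\mu$-almost every $u$. -/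

import Mathlib

open MeasureTheory

namespace EOT

/-- Euclidean space `ℝ^d`. -/
abbrev E (d : ℕ) : Type := EuclideanSpace ℝ (Fin d)

/-- The open unit ball `B^d`. -/
def unitBall (d : ℕ) : Set (E d) := Metric.ball (0 : E d) 1

/-- The uniform probability measure on `B^d`. -/
noncomputable def unifBall (d : ℕ) : Measure (E d) :=
  ProbabilityTheory.cond (volume : Measure (E d)) (unitBall d)

/-- The quadratic cost `‖u - x‖² / 2`. -/
noncomputable def cost {d : ℕ} (u x : E d) : ℝ := ‖u - x‖ ^ 2 / 2

/-- `π` is a coupling of `μ` and `ν`. -/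
def IsCoupling {d : ℕ} (μ ν : Measure (E d)) (π : Measure (E d × E d)) : Prop :=
  π.map Prod.fst = μ ∧ π.map Prod.snd = ν

/-- The entropy regularised Kantorovich functional
`∫ ‖u - x‖² / 2 dπ(u, x) + ε KL(π | μ ⊗ ν)`, with values in `[0, ∞]`. -/
noncomputable def primalObjective {d : ℕ} (ε : ℝ) (μ ν : Measure (E d))
    (π : Measure (E d × E d)) : ENNReal :=
  (∫⁻ p, ENNReal.ofReal (cost p.1 p.2) ∂π) +
    ENNReal.ofReal ε * InformationTheory.klDiv π (μ.prod ν)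

/-- `π` is an optimal coupling for the entropy regularised Kantorovich problem. -/
def IsEOTPlan {d : ℕ} (ε : ℝ) (μ ν : Measure (E d)) (π : Measure (E d × E d)) : Prop :=
  IsCoupling μ ν π ∧
    ∀ π' : Measure (E d × E d), IsCoupling μ ν π' →
      primalObjective ε μ ν π ≤ primalObjective ε μ ν π'

/-- `T` is (a version of) the EOT map of `ν`: `T(u) = E[X | U = u]` with `(U, X)` distributed
according to the entropic optimal coupling of the uniform measure on `B^d` and `ν`. -/
def IsEOTMap {d : ℕ} (ε : ℝ) (ν : Measure (E d)) (T : E d → E d) : Prop :=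
  AEStronglyMeasurable T (unifBall d) ∧
    ∃ π : Measure (E d × E d), IsEOTPlan ε (unifBall d) ν π ∧
      (fun p : E d × E d => T p.1) =ᵐ[π]
        condExp (MeasurableSpace.comap (Prod.fst : E d × E d → E d) inferInstance) π
          (Prod.snd : E d × E d → E d)

/-- The dual functional
`∫ φ dμ + ∫ ψ dν - ε ∫ exp ((φ(u) + ψ(x) - ‖u - x‖² / 2) / ε) d(μ ⊗ ν) + ε`,
equal to `-∞` where the exponential is not integrable. -/
noncomputable def dualObjective {d : ℕ} (ε : ℝ) (μ ν : Measure (E d)) (φ ψ : E d → ℝ) : EReal :=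
  (((∫ u, φ u ∂μ) + (∫ x, ψ x ∂ν) + ε : ℝ) : EReal) -
    ((ENNReal.ofReal ε *
      ∫⁻ p, ENNReal.ofReal (Real.exp ((φ p.1 + ψ p.2 - cost p.1 p.2) / ε)) ∂(μ.prod ν) :
        ENNReal) : EReal)

/-- `(φ, ψ)` maximises the dual functional over `L¹(μ) × L¹(ν)`. -/
def IsDualMaximiser {d : ℕ} (ε : ℝ) (μ ν : Measure (E d)) (φ ψ : E d → ℝ) : Prop :=
  Integrable φ μ ∧ Integrable ψ ν ∧
    ∀ φ' ψ' : E d → ℝ, Integrable φ' μ → Integrable ψ' ν →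
      dualObjective ε μ ν φ' ψ' ≤ dualObjective ε μ ν φ ψ

/-- `f` is the EOT potential of `ν` with base point `u₀`:
`f(u) = (‖u‖² / 2 - φ(u)) - (‖u₀‖² / 2 - φ(u₀))` on `B^d`, where `(φ, ψ)` is a dual maximiser.
An element of `L¹(μ)` has no value at the point `u₀`, so `φ` is taken to be the
representative that is continuous on `B^d`. -/
def IsEOTPotential {d : ℕ} (ε : ℝ) (ν : Measure (E d)) (u₀ : E d) (f : E d → ℝ) : Prop :=
  ∃ φ ψ : E d → ℝ, IsDualMaximiser ε (unifBall d) ν φ ψ ∧ ContinuousOn φ (unitBall d) ∧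
    ∀ u ∈ unitBall d, f u = (‖u‖ ^ 2 / 2 - φ u) - (‖u₀‖ ^ 2 / 2 - φ u₀)

/-- The rule "take the base point `u` to be a minimiser over `B^d` whenever there is one, and
the given point `u₀` otherwise". As a potential `f` differs from `‖u‖² / 2 - φ(u)` by a constant,
the two have the same minimisers. -/
def IsMinBasePoint {d : ℕ} (u₀ : E d) (f : E d → ℝ) (u : E d) : Prop :=
  u ∈ unitBall d ∧
    (IsMinOn f (unitBall d) u ∨ ((¬ ∃ v ∈ unitBall d, IsMinOn f (unitBall d) v) ∧ u = u₀))

end EOT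

/-!
For Schrödinger potentials `(φ, ψ)` of the uniform measure `μ` on the ball and `ν`, that is, when
`exp ((φ(u) + ψ(x) - ‖u - x‖² / 2) / ε)` is the density with respect to `μ ⊗ ν` of a coupling, put
`ρ = exp ((ψ(x) - ‖x‖² / 2) / ε) ν` (`reweighted`). The first marginal equation says that the
Laplace transform of `ρ` at `u / ε` is `exp ((‖u‖² / 2 - φ(u)) / ε)`. A Laplace transform that is
finite on a ball determines the measure (`ext_of_laplace_eqOn`), so `φ` determines `ρ`, and the
second marginal equation then recovers `ν` from `φ` and `ρ`. The constant left free in `φ` cancels.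
Hence `φ`, modulo constants, determines `ν` (`IsSchrodinger.measure_eq`).

A dual maximiser consists of Schrödinger potentials: its Euler–Lagrange equations in the
directions of indicator functions are the marginal equations
(`IsDualMaximiser.exists_isSchrodinger`). This gives the claim for the EOT potentials. Conversely,
for one measure `ν` the maximiser is unique up to constants, since for two maximisers the
difference of `φ ⊕ ψ` has the same sign as the difference of the densities and integrates to zero
against it (`IsSchrodinger.ae_eq_add_const`). Both base point rules fix the constant.

For the EOT maps, the entropic optimal coupling is shown to be given by Schrödinger potentials
(`IsEOTPlan.exists_isSchrodinger`) without solving the dual problem. Its density `p` is positive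
(`IsMinDensity.ae_pos`), and by first order optimality `A = c + ε log p` has the same integral
against two parts of the coupling with the same marginals. Exchanging mass at `(u, x)`, `(u', x')`
for mass at `(u, x')`, `(u', x)` gives `A(u, x) + A(u', x') = A(u, x') + A(u', x)` almost everywhere
(`IsMinDensity.ae_fourPoint`), and freezing `(u', x')` writes `A` as a sum `φ(u) + ψ(x)`. The EOT
map is then the gradient of the logarithm of the Laplace transform of `ρ`
(`IsSchrodinger.ae_eq_logGrad`). It is continuous on the ball, so two EOT maps that agree almost
everywhere have potentials `φ` that differ by a constant, and the measures agree. Conversely, the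
optimal coupling is unique by strict convexity of the entropy (`IsMinDensity.ae_eq`).
-/

namespace EOT

open scoped ENNReal Topology RealInnerProductSpace

/-! ### Laplace transforms of measures on `ℝ^d` -/

section Laplace

variable {d : ℕ}

/-- The Laplace transform `u ↦ ∫ exp ⟪u, x⟫ dρ(x)` of a measure on `ℝ^d`. -/
noncomputable def laplace (ρ : Measure (E d)) (u : E d) : ℝ := ∫ x, Real.exp ⟪u, x⟫ ∂ρ

/-- The vector-valued integral `∫ exp ⟪u, x⟫ x dρ(x)`, which is the gradient of the Laplace
transform. -/
noncomputable def laplaceGrad (ρ : Measure (E d)) (u : E d) : E d :=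
  ∫ x, Real.exp ⟪u, x⟫ • x ∂ρ

lemma exists_norm_le_mul_abs {x : E d} (hx : x ≠ 0) : ∃ i, ‖x‖ ≤ d * |x i| := by
  have hd : (Finset.univ : Finset (Fin d)).Nonempty := by
    rcases Nat.eq_zero_or_pos d with rfl | h
    · exact absurd (Subsingleton.elim x 0) hx
    · exact ⟨⟨0, h⟩, Finset.mem_univ _⟩
  have hsum : ‖x‖ ≤ ∑ i, |x i| := by
    calc ‖x‖ = ‖∑ i, x i • EuclideanSpace.basisFun (Fin d) ℝ i‖ := by
          conv_lhs => rw [← (EuclideanSpace.basisFun (Fin d) ℝ).sum_repr x]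
          simp
      _ ≤ ∑ i, ‖x i • EuclideanSpace.basisFun (Fin d) ℝ i‖ := norm_sum_le _ _
      _ = ∑ i, |x i| := by simp [norm_smul]
  obtain ⟨i, -, hi⟩ := Finset.exists_le_of_sum_le (s := (Finset.univ : Finset (Fin d)))
    (f := fun _ => ‖x‖) (g := fun i => d * |x i|) hd (by
      rw [← Finset.mul_sum]
      simp only [Finset.sum_const, Finset.card_univ, Fintype.card_fin, nsmul_eq_mul]
      gcongr)
  exact ⟨i, hi⟩

/-- Finiteness of the Laplace transform on an open set self-improves: the weight `exp ⟪u, x⟫` may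
be multiplied by `exp (r ‖x‖)` for a small `r`. Indeed `exp (r ‖x‖)` is at most a finite sum of
exponentials of multiples of coordinates. -/
lemma exists_integrable_exp_add_norm {ρ : Measure (E d)} {U : Set (E d)} (hU : IsOpen U)
    (h : ∀ u ∈ U, Integrable (fun x => Real.exp ⟪u, x⟫) ρ) {u : E d} (hu : u ∈ U) :
    ∃ r > 0, Integrable (fun x => Real.exp (⟪u, x⟫ + r * ‖x‖)) ρ := by
  obtain ⟨δ, hδ, hball⟩ := Metric.isOpen_iff.1 hU u hu
  set b : Fin d → E d := fun i => EuclideanSpace.basisFun (Fin d) ℝ i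
  set r : ℝ := δ / (2 * (d + 1)) with hr
  have hr0 : 0 < r := by positivity
  have hdr : d * r < δ := by
    rw [hr, mul_div_assoc', div_lt_iff₀ (by positivity)]
    nlinarith [(Nat.cast_nonneg d : (0 : ℝ) ≤ d)]
  have hb : ∀ i, ‖b i‖ = 1 := fun i => by simp [b]
  have hmem : ∀ i, ∀ s : ℝ, |s| = 1 → u + (s * (d * r)) • b i ∈ U := by
    intro i s hs
    apply hball
    rw [mem_ball_iff_norm, add_sub_cancel_left, norm_smul, hb, mul_one, norm_mul, Real.norm_eq_abs,
      hs, one_mul, Real.norm_eq_abs, abs_of_nonneg (by positivity)]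
    exact hdr
  refine ⟨r, hr0, ?_⟩
  have hg : Integrable (fun x => Real.exp ⟪u, x⟫ +
      ∑ i, (Real.exp ⟪u + (1 * (d * r)) • b i, x⟫ + Real.exp ⟪u + (-1 * (d * r)) • b i, x⟫)) ρ :=
    (h u hu).add (integrable_finsetSum _ fun i _ =>
      (h _ (hmem i 1 (by simp))).add (h _ (hmem i (-1) (by simp))))
  refine hg.mono' (by fun_prop) (Filter.Eventually.of_forall fun x => ?_)
  rw [Real.norm_eq_abs, Real.abs_exp]
  have hpos : ∀ i, 0 ≤ Real.exp ⟪u + (1 * (d * r)) • b i, x⟫ +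
      Real.exp ⟪u + (-1 * (d * r)) • b i, x⟫ := fun i => by positivity
  by_cases hx : x = 0
  · subst hx
    have := Finset.sum_nonneg fun i (_ : i ∈ Finset.univ) => hpos i
    simp only [inner_zero_right, norm_zero, mul_zero, add_zero, Real.exp_zero] at this ⊢
    linarith
  · obtain ⟨i, hi⟩ := exists_norm_le_mul_abs hx
    have h1 := Finset.single_le_sum (fun i _ => hpos i) (Finset.mem_univ i)
    have hin : ⟪b i, x⟫ = x i := by simp [b, EuclideanSpace.inner_single_left]
    have hrx : r * ‖x‖ ≤ d * r * |x i| := by nlinarith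
    refine le_trans ?_ (le_trans h1 (le_add_of_nonneg_left (Real.exp_pos _).le))
    simp only [inner_add_left, real_inner_smul_left, hin]
    rcases abs_cases (x i) with ⟨ha, -⟩ | ⟨ha, -⟩
    · refine le_trans (Real.exp_le_exp.2 ?_) (le_add_of_nonneg_right (Real.exp_pos _).le)
      rw [ha] at hrx; linarith
    · refine le_trans (Real.exp_le_exp.2 ?_) (le_add_of_nonneg_left (Real.exp_pos _).le)
      rw [ha] at hrx; linarith

/-- A locally uniform integrable majorant for the integrands of `laplaceGrad`. -/
lemma exists_bound_exp_mul_norm {ρ : Measure (E d)} {U : Set (E d)} (hU : IsOpen U)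
    (h : ∀ u ∈ U, Integrable (fun x => Real.exp ⟪u, x⟫) ρ) {u : E d} (hu : u ∈ U) :
    ∃ r > 0, ∃ g : E d → ℝ, Integrable g ρ ∧
      ∀ v ∈ Metric.ball u r, ∀ x, Real.exp ⟪v, x⟫ * ‖x‖ ≤ g x := by
  obtain ⟨r, hr, hint⟩ := exists_integrable_exp_add_norm hU h hu
  refine ⟨r / 2, by positivity, _, hint.const_mul (2 / r), fun v hv x => ?_⟩
  have h1 : ⟪v, x⟫ ≤ ⟪u, x⟫ + r / 2 * ‖x‖ := by
    have h2 : ⟪v - u, x⟫ ≤ ‖v - u‖ * ‖x‖ := real_inner_le_norm _ _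
    have h3 : ‖v - u‖ < r / 2 := mem_ball_iff_norm.1 hv
    rw [inner_sub_left] at h2
    nlinarith [norm_nonneg x]
  have h2 : ‖x‖ ≤ 2 / r * Real.exp (r / 2 * ‖x‖) := by
    have := Real.add_one_le_exp (r / 2 * ‖x‖)
    calc ‖x‖ = 2 / r * (r / 2 * ‖x‖) := by field_simp
      _ ≤ _ := by gcongr; linarith
  calc Real.exp ⟪v, x⟫ * ‖x‖
      ≤ Real.exp (⟪u, x⟫ + r / 2 * ‖x‖) * (2 / r * Real.exp (r / 2 * ‖x‖)) := by gcongr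
    _ = 2 / r * (Real.exp (⟪u, x⟫ + r / 2 * ‖x‖) * Real.exp (r / 2 * ‖x‖)) := by ring
    _ = 2 / r * Real.exp (⟪u, x⟫ + r * ‖x‖) := by rw [← Real.exp_add]; ring_nf

lemma hasFDerivAt_laplace {ρ : Measure (E d)} {U : Set (E d)} (hU : IsOpen U)
    (h : ∀ u ∈ U, Integrable (fun x => Real.exp ⟪u, x⟫) ρ) {u : E d} (hu : u ∈ U) :
    HasFDerivAt (laplace ρ) (innerSL ℝ (laplaceGrad ρ u)) u := by
  obtain ⟨r, hr, g, hg, hbound⟩ := exists_bound_exp_mul_norm hU h hu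
  have hint : Integrable (fun x : E d => Real.exp ⟪u, x⟫ • x) ρ :=
    hg.mono' (by fun_prop) (Filter.Eventually.of_forall fun x => by
      rw [norm_smul, Real.norm_eq_abs, Real.abs_exp]
      exact hbound u (Metric.mem_ball_self hr) x)
  have key := hasFDerivAt_integral_of_dominated_of_fderiv_le (𝕜 := ℝ) (μ := ρ)
    (F := fun (u x : E d) => Real.exp ⟪u, x⟫)
    (F' := fun u x => innerSL ℝ (Real.exp ⟪u, x⟫ • x)) (x₀ := u) (bound := g)
    (Metric.ball_mem_nhds u hr) (Filter.Eventually.of_forall fun v => by fun_prop) (h u hu)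
    (by fun_prop)
    (Filter.Eventually.of_forall fun x v hv => by
      rw [innerSL_apply_norm, norm_smul, Real.norm_eq_abs, Real.abs_exp]
      exact hbound v hv x) hg
    (Filter.Eventually.of_forall fun x v hv => by
      have h1 : HasFDerivAt (fun v : E d => ⟪v, x⟫) (innerSL ℝ x) v := by
        have := (innerSL ℝ x).hasFDerivAt (x := v)
        refine this.congr_of_eventuallyEq (Filter.Eventually.of_forall fun w => ?_)
        simp [real_inner_comm]
      have := h1.exp
      simpa using this)
  rwa [ContinuousLinearMap.integral_comp_comm _ hint] at key

lemma continuousOn_laplaceGrad {ρ : Measure (E d)} {U : Set (E d)} (hU : IsOpen U)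
    (h : ∀ u ∈ U, Integrable (fun x => Real.exp ⟪u, x⟫) ρ) :
    ContinuousOn (laplaceGrad ρ) U := by
  intro u hu
  obtain ⟨r, hr, g, hg, hbound⟩ := exists_bound_exp_mul_norm hU h hu
  refine ContinuousAt.continuousWithinAt ?_
  refine continuousAt_of_dominated (bound := g) (Filter.Eventually.of_forall fun v => by fun_prop)
    ?_ hg (Filter.Eventually.of_forall fun x => by fun_prop)
  filter_upwards [Metric.ball_mem_nhds u hr] with v hv
  refine Filter.Eventually.of_forall fun x => ?_
  rw [norm_smul, Real.norm_eq_abs, Real.abs_exp]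
  exact hbound v hv x

lemma laplace_pos {ρ : Measure (E d)} (hρ : ρ ≠ 0) {u : E d}
    (h : Integrable (fun x => Real.exp ⟪u, x⟫) ρ) : 0 < laplace ρ u := by
  have : NeZero ρ := ⟨hρ⟩
  exact integral_exp_pos h

/-- Two Laplace transforms with the same logarithmic gradient are proportional. -/
lemma exists_laplace_eq_mul {ρ₁ ρ₂ : Measure (E d)} (hρ₁ : ρ₁ ≠ 0) (hρ₂ : ρ₂ ≠ 0) {U : Set (E d)}
    (hU : IsOpen U) (hc : IsPreconnected U)
    (h₁ : ∀ u ∈ U, Integrable (fun x => Real.exp ⟪u, x⟫) ρ₁)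
    (h₂ : ∀ u ∈ U, Integrable (fun x => Real.exp ⟪u, x⟫) ρ₂)
    (h : ∀ u ∈ U, (laplace ρ₁ u)⁻¹ • laplaceGrad ρ₁ u = (laplace ρ₂ u)⁻¹ • laplaceGrad ρ₂ u) :
    ∃ C > 0, ∀ u ∈ U, laplace ρ₁ u = C * laplace ρ₂ u := by
  have hd : ∀ (ρ : Measure (E d)) (_ : ρ ≠ 0)
      (_ : ∀ u ∈ U, Integrable (fun x => Real.exp ⟪u, x⟫) ρ), ∀ u ∈ U,
      HasFDerivAt (fun u => Real.log (laplace ρ u))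
        (innerSL ℝ ((laplace ρ u)⁻¹ • laplaceGrad ρ u)) u := fun ρ hρ hi u hu => by
    simpa using (hasFDerivAt_laplace hU hi hu).log (laplace_pos hρ (hi u hu)).ne'
  have hd' : ∀ u ∈ U, HasFDerivAt (fun u => Real.log (laplace ρ₁ u) - Real.log (laplace ρ₂ u))
      (0 : E d →L[ℝ] ℝ) u := fun u hu => by
    have := (hd ρ₁ hρ₁ h₁ u hu).sub (hd ρ₂ hρ₂ h₂ u hu)
    rw [h u hu, sub_self] at this
    exact this
  obtain ⟨a, ha⟩ := hU.exists_is_const_of_fderiv_eq_zero hc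
    (fun u hu => (hd' u hu).differentiableAt.differentiableWithinAt)
    (fun u hu => (hd' u hu).fderiv)
  refine ⟨Real.exp a, Real.exp_pos a, fun u hu => ?_⟩
  have hp₁ := laplace_pos hρ₁ (h₁ u hu)
  have hp₂ := laplace_pos hρ₂ (h₂ u hu)
  rw [← Real.exp_log hp₁, ← Real.exp_log hp₂, ← Real.exp_add]
  congr 1
  linarith [ha u hu]

/-- A measure is determined by its Laplace transform on a neighbourhood of the origin: along each
line the transform extends analytically to a complex strip that contains the imaginary axis, where
it is the characteristic function. -/
lemma ext_of_laplace_eqOn {ρ₁ ρ₂ : Measure (E d)} {R : ℝ} (hR : 0 < R)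
    (h₁ : ∀ u ∈ Metric.ball (0 : E d) R, Integrable (fun x => Real.exp ⟪u, x⟫) ρ₁)
    (h₂ : ∀ u ∈ Metric.ball (0 : E d) R, Integrable (fun x => Real.exp ⟪u, x⟫) ρ₂)
    (h : ∀ u ∈ Metric.ball (0 : E d) R, laplace ρ₁ u = laplace ρ₂ u) : ρ₁ = ρ₂ := by
  have hfin : ∀ (ρ : Measure (E d))
      (_ : ∀ u ∈ Metric.ball (0 : E d) R, Integrable (fun x => Real.exp ⟪u, x⟫) ρ),
      IsFiniteMeasure ρ := fun ρ hρ => by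
    have := hρ 0 (Metric.mem_ball_self hR)
    simpa [integrable_const_iff] using this
  have := hfin ρ₁ h₁
  have := hfin ρ₂ h₂
  refine Measure.ext_of_charFun (funext fun t => ?_)
  set X : E d → ℝ := fun x => ⟪t, x⟫
  -- Adding `1` to `‖t‖` keeps the width of the strip positive and finite for `t = 0` as well.
  set δ : ℝ := R / (‖t‖ + 1) with hδ
  have hδ0 : 0 < δ := by positivity
  have hmem : ∀ s ∈ Set.Ioo (-δ) δ, s • t ∈ Metric.ball (0 : E d) R := fun s hs => by
    rw [mem_ball_zero_iff, norm_smul, Real.norm_eq_abs]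
    have hs' : |s| < δ := abs_lt.2 hs
    calc |s| * ‖t‖ ≤ |s| * (‖t‖ + 1) := by gcongr; linarith
      _ < δ * (‖t‖ + 1) := by gcongr
      _ = R := by rw [hδ]; field_simp
  have hsub : ∀ (ρ : Measure (E d))
      (_ : ∀ u ∈ Metric.ball (0 : E d) R, Integrable (fun x => Real.exp ⟪u, x⟫) ρ),
      Set.Ioo (-δ) δ ⊆ interior (ProbabilityTheory.integrableExpSet X ρ) := fun ρ hρ =>
    interior_maximal (fun s hs => by
      have := hρ _ (hmem s hs)
      simpa only [ProbabilityTheory.integrableExpSet, Set.mem_ofPred_eq, X, real_inner_smul_left]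
        using this) isOpen_Ioo
  set S : Set ℂ := {z | z.re ∈ Set.Ioo (-δ) δ}
  have hSc : IsPreconnected S :=
    ((convex_Ioo (-δ) δ).linear_preimage Complex.reLm).isPreconnected
  have hS0 : (0 : ℂ) ∈ S := by simp [S, hδ0]
  have hSI : Complex.I ∈ S := by simp [S, hδ0]
  have han : ∀ (ρ : Measure (E d))
      (_ : ∀ u ∈ Metric.ball (0 : E d) R, Integrable (fun x => Real.exp ⟪u, x⟫) ρ),
      AnalyticOnNhd ℂ (ProbabilityTheory.complexMGF X ρ) S := fun ρ hρ z hz =>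
    ProbabilityTheory.analyticAt_complexMGF (hsub ρ hρ hz)
  have hreal : ∀ s ∈ Set.Ioo (-δ) δ,
      ProbabilityTheory.complexMGF X ρ₁ (s : ℂ) = ProbabilityTheory.complexMGF X ρ₂ (s : ℂ) := by
    intro s hs
    rw [ProbabilityTheory.complexMGF_ofReal, ProbabilityTheory.complexMGF_ofReal]
    have := h _ (hmem s hs)
    simp only [laplace, real_inner_smul_left] at this
    simp only [ProbabilityTheory.mgf, X, this]
  have hfreq : ∃ᶠ z in 𝓝[≠] (0 : ℂ),
      ProbabilityTheory.complexMGF X ρ₁ z = ProbabilityTheory.complexMGF X ρ₂ z := by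
    have ht : Filter.Tendsto (fun s : ℝ => (s : ℂ)) (𝓝[≠] 0) (𝓝[≠] 0) := by
      refine tendsto_nhdsWithin_of_tendsto_nhds_of_eventually_within _ ?_ ?_
      · exact (Complex.continuous_ofReal.tendsto' 0 0 (by simp)).mono_left nhdsWithin_le_nhds
      · filter_upwards [self_mem_nhdsWithin] with s hs
        simpa using hs
    refine ht.frequently (Filter.Eventually.frequently ?_)
    filter_upwards [nhdsWithin_le_nhds (Ioo_mem_nhds (neg_lt_zero.2 hδ0) hδ0)] with s hs
    exact hreal s hs
  have hI := (han ρ₁ h₁).eqOn_of_preconnected_of_frequently_eq (han ρ₂ h₂) hSc hS0 hfreq hSI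
  simpa only [ProbabilityTheory.complexMGF, X, charFun_apply, mul_comm Complex.I,
    real_inner_comm] using hI

end Laplace

/-! ### Measures given by a real density -/

section Density

variable {Ω : Type*} [MeasurableSpace Ω] {P : Measure Ω} {p q : Ω → ℝ}

/-- The measure whose density with respect to `P` is the real-valued function `p`
(its negative part is ignored). -/
noncomputable def ofDensity (P : Measure Ω) (p : Ω → ℝ) : Measure Ω :=
  P.withDensity fun z => ENNReal.ofReal (p z)

lemma ofDensity_congr (h : p =ᵐ[P] q) : ofDensity P p = ofDensity P q :=
  withDensity_congr_ae (h.mono fun z hz => by simp only [hz])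

lemma ofDensity_add (hp : Measurable p) (hp0 : ∀ z, 0 ≤ p z) (hq0 : ∀ z, 0 ≤ q z) :
    ofDensity P (fun z => p z + q z) = ofDensity P p + ofDensity P q := by
  rw [ofDensity, ofDensity, ofDensity, ← withDensity_add_left hp.ennreal_ofReal]
  congr 1
  funext z
  exact ENNReal.ofReal_add (hp0 z) (hq0 z)

lemma ofDensity_const_mul {t : ℝ} (ht : 0 ≤ t) (hp : Measurable p) :
    ofDensity P (fun z => t * p z) = ENNReal.ofReal t • ofDensity P p := by
  rw [ofDensity, ofDensity, ← withDensity_smul _ hp.ennreal_ofReal]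
  congr 1
  funext z
  exact ENNReal.ofReal_mul ht

lemma ofDensity_mul (hp : Measurable p) (hp0 : ∀ z, 0 ≤ p z) (hq : Measurable q) :
    ofDensity P (fun z => p z * q z) = ofDensity (ofDensity P p) q := by
  rw [ofDensity, ofDensity, ofDensity, ← withDensity_mul _ hp.ennreal_ofReal hq.ennreal_ofReal]
  congr 1
  funext z
  exact ENNReal.ofReal_mul (hp0 z)

lemma integrable_ofDensity_iff (hp : Measurable p) (hp0 : ∀ z, 0 ≤ p z) {F : Type*}
    [NormedAddCommGroup F] [NormedSpace ℝ F] {f : Ω → F} :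
    Integrable f (ofDensity P p) ↔ Integrable (fun z => p z • f z) P := by
  rw [ofDensity, integrable_withDensity_iff_integrable_smul' hp.ennreal_ofReal
    (Filter.Eventually.of_forall fun _ => ENNReal.ofReal_lt_top)]
  simp only [ENNReal.toReal_ofReal (hp0 _)]

lemma integral_ofDensity (hp : Measurable p) (hp0 : ∀ z, 0 ≤ p z) {F : Type*}
    [NormedAddCommGroup F] [NormedSpace ℝ F] (f : Ω → F) :
    ∫ z, f z ∂(ofDensity P p) = ∫ z, p z • f z ∂P := by
  rw [ofDensity, integral_withDensity_eq_integral_toReal_smul hp.ennreal_ofReal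
    (Filter.Eventually.of_forall fun _ => ENNReal.ofReal_lt_top)]
  simp only [ENNReal.toReal_ofReal (hp0 _)]

/-- A measure dominated by a finite measure `π` has a density with values in `[0, 1]`. -/
lemma exists_ofDensity_of_le {π κ : Measure Ω} [IsFiniteMeasure π] (h : κ ≤ π) :
    ∃ r : Ω → ℝ, Measurable r ∧ (∀ z, 0 ≤ r z) ∧ (∀ z, r z ≤ 1) ∧ κ = ofDensity π r := by
  have : IsFiniteMeasure κ := isFiniteMeasure_of_le π h
  refine ⟨fun z => (min (κ.rnDeriv π z) 1).toReal, by fun_prop, fun z => ENNReal.toReal_nonneg,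
    fun z => ENNReal.toReal_le_of_le_ofReal zero_le_one (by simp), ?_⟩
  conv_lhs => rw [← Measure.withDensity_rnDeriv_eq κ π (Measure.absolutelyContinuous_of_le h)]
  refine withDensity_congr_ae ?_
  filter_upwards [Measure.rnDeriv_le_one_of_le h] with z hz
  rw [ENNReal.ofReal_toReal (by simp), min_eq_left (show κ.rnDeriv π z ≤ 1 from hz)]

end Density

/-! ### Densities minimising the entropy regularised cost -/

section Minimal

open InformationTheory

/-- A second order upper bound for the entropy under a relative perturbation of the density. -/
lemma klFun_mul_one_add_le {p s : ℝ} (hp : 0 ≤ p) (hs : -1 < s) :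
    klFun (p * (1 + s)) ≤ klFun p + s * (p * Real.log p) + p * s ^ 2 := by
  rcases hp.eq_or_lt with rfl | hp
  · simp [klFun]
  · have h1 : Real.log (1 + s) ≤ s := by
      linarith [Real.log_le_sub_one_of_pos (x := 1 + s) (by linarith)]
    have h2 : (1 + s) * Real.log (1 + s) ≤ (1 + s) * s := by gcongr; linarith
    simp only [klFun]
    rw [Real.log_mul hp.ne' (by linarith)]
    nlinarith

variable {X Y : Type*} [MeasurableSpace X] [MeasurableSpace Y]

/-- `p` is the density with respect to `μ ⊗ ν` of a coupling of `μ` and `ν`. -/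
structure HasMarginals (μ : Measure X) (ν : Measure Y) (p : X × Y → ℝ) : Prop where
  measurable : Measurable p
  nonneg : ∀ z, 0 ≤ p z
  map_fst : (ofDensity (μ.prod ν) p).map Prod.fst = μ
  map_snd : (ofDensity (μ.prod ν) p).map Prod.snd = ν

variable {μ : Measure X} {ν : Measure Y} {p q c : X × Y → ℝ} {ε : ℝ}

lemma HasMarginals.isProbabilityMeasure [IsProbabilityMeasure μ] (hp : HasMarginals μ ν p) :
    IsProbabilityMeasure (ofDensity (μ.prod ν) p) := by
  have : IsProbabilityMeasure ((ofDensity (μ.prod ν) p).map Prod.fst) := by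
    rw [hp.map_fst]; infer_instance
  exact Measure.isProbabilityMeasure_of_map Prod.fst

lemma HasMarginals.integrable [IsProbabilityMeasure μ] (hp : HasMarginals μ ν p) :
    Integrable p (μ.prod ν) := by
  have := hp.isProbabilityMeasure
  simpa using (integrable_ofDensity_iff hp.measurable hp.nonneg).1
    (integrable_const (μ := ofDensity (μ.prod ν) p) (1 : ℝ))

lemma HasMarginals.integral_eq_one [IsProbabilityMeasure μ] (hp : HasMarginals μ ν p) :
    ∫ z, p z ∂(μ.prod ν) = 1 := by
  have := hp.isProbabilityMeasure
  have h := integral_ofDensity (P := μ.prod ν) hp.measurable hp.nonneg (fun _ => (1 : ℝ))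
  simpa using h.symm

lemma hasMarginals_one [IsProbabilityMeasure μ] [IsProbabilityMeasure ν] :
    HasMarginals μ ν fun _ => 1 where
  measurable := measurable_const
  nonneg _ := zero_le_one
  map_fst := by simp [ofDensity, Measure.map_fst_prod]
  map_snd := by simp [ofDensity, Measure.map_snd_prod]

lemma HasMarginals.convexComb (hp : HasMarginals μ ν p) (hq : HasMarginals μ ν q) {s t : ℝ}
    (hs : 0 ≤ s) (ht : 0 ≤ t) (hst : s + t = 1) :
    HasMarginals μ ν fun z => s * p z + t * q z := by
  have hp1 := hp.measurable
  have hq1 := hq.measurable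
  have key : ofDensity (μ.prod ν) (fun z => s * p z + t * q z) =
      ENNReal.ofReal s • ofDensity (μ.prod ν) p + ENNReal.ofReal t • ofDensity (μ.prod ν) q := by
    rw [ofDensity_add (by fun_prop) (fun z => mul_nonneg hs (hp.nonneg z))
      (fun z => mul_nonneg ht (hq.nonneg z)), ofDensity_const_mul hs hp1,
      ofDensity_const_mul ht hq1]
  have hst' : ENNReal.ofReal s + ENNReal.ofReal t = 1 := by
    rw [← ENNReal.ofReal_add hs ht, hst, ENNReal.ofReal_one]
  exact
  { measurable := by fun_prop
    nonneg := fun z => add_nonneg (mul_nonneg hs (hp.nonneg z)) (mul_nonneg ht (hq.nonneg z))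
    map_fst := by
      rw [key, Measure.map_add _ _ measurable_fst, Measure.map_smul, Measure.map_smul,
        hp.map_fst, hq.map_fst, ← add_smul, hst', one_smul]
    map_snd := by
      rw [key, Measure.map_add _ _ measurable_snd, Measure.map_smul, Measure.map_smul,
        hp.map_snd, hq.map_snd, ← add_smul, hst', one_smul] }

lemma map_eq_of_add_eq {Ω Z : Type*} [MeasurableSpace Ω] [MeasurableSpace Z] {f : Ω → Z}
    (hf : Measurable f) {π π' κ₁ κ₂ : Measure Ω} [IsFiniteMeasure κ₁]
    (h : π' + κ₂ = π + κ₁) (hκ : κ₁.map f = κ₂.map f) : π'.map f = π.map f := by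
  have h1 := congrArg (Measure.map f) h
  rw [Measure.map_add _ _ hf, Measure.map_add _ _ hf, ← hκ, add_comm, add_comm (π.map f)] at h1
  exact (Measure.add_right_inj _ _ _).1 h1

/-- Exchanging a small multiple of one part of a coupling for another part with the same marginals
gives again a coupling. -/
lemma HasMarginals.exchange [IsProbabilityMeasure μ] [IsProbabilityMeasure ν]
    (hp : HasMarginals μ ν p) {r₁ r₂ : X × Y → ℝ}
    (hr₁ : Measurable r₁) (hr₁0 : ∀ z, 0 ≤ r₁ z) (hr₁1 : ∀ z, r₁ z ≤ 1)
    (hr₂ : Measurable r₂) (hr₂0 : ∀ z, 0 ≤ r₂ z) (hr₂1 : ∀ z, r₂ z ≤ 1)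
    (hfst : (ofDensity (μ.prod ν) fun z => p z * r₁ z).map Prod.fst =
      (ofDensity (μ.prod ν) fun z => p z * r₂ z).map Prod.fst)
    (hsnd : (ofDensity (μ.prod ν) fun z => p z * r₁ z).map Prod.snd =
      (ofDensity (μ.prod ν) fun z => p z * r₂ z).map Prod.snd)
    {t : ℝ} (ht : 0 ≤ t) (ht1 : t ≤ 1) :
    HasMarginals μ ν fun z => p z * (1 + t * (r₁ z - r₂ z)) := by
  have hp1 := hp.measurable
  have hq0 : ∀ z, 0 ≤ p z * (1 + t * (r₁ z - r₂ z)) := fun z =>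
    mul_nonneg (hp.nonneg z) (by nlinarith [hr₁0 z, hr₂1 z])
  have e1 : ∀ r : X × Y → ℝ, Measurable r →
      ofDensity (μ.prod ν) (fun z => t * (p z * r z)) =
        ENNReal.ofReal t • ofDensity (μ.prod ν) fun z => p z * r z := fun r hr =>
    ofDensity_const_mul ht (by fun_prop)
  have hint : Integrable (fun z => t * (p z * r₁ z)) (μ.prod ν) := by
    refine (hp.integrable.mono' (by fun_prop) (Filter.Eventually.of_forall fun z => ?_)).const_mul t
    rw [Real.norm_of_nonneg (mul_nonneg (hp.nonneg z) (hr₁0 z))]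
    exact mul_le_of_le_one_right (hp.nonneg z) (hr₁1 z)
  have hfin : IsFiniteMeasure (ofDensity (μ.prod ν) fun z => t * (p z * r₁ z)) :=
    isFiniteMeasure_withDensity_ofReal hint.2
  have hadd : ofDensity (μ.prod ν) (fun z => p z * (1 + t * (r₁ z - r₂ z))) +
      ofDensity (μ.prod ν) (fun z => t * (p z * r₂ z)) =
      ofDensity (μ.prod ν) p + ofDensity (μ.prod ν) (fun z => t * (p z * r₁ z)) := by
    rw [← ofDensity_add (by fun_prop) hq0
      (fun z => mul_nonneg ht (mul_nonneg (hp.nonneg z) (hr₂0 z))),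
      ← ofDensity_add hp1 hp.nonneg (fun z => mul_nonneg ht (mul_nonneg (hp.nonneg z) (hr₁0 z)))]
    congr 1
    funext z
    ring
  exact
  { measurable := by fun_prop
    nonneg := hq0
    map_fst := by
      rw [map_eq_of_add_eq measurable_fst hadd (by
        rw [e1 _ hr₁, e1 _ hr₂, Measure.map_smul, Measure.map_smul, hfst]), hp.map_fst]
    map_snd := by
      rw [map_eq_of_add_eq measurable_snd hadd (by
        rw [e1 _ hr₁, e1 _ hr₂, Measure.map_smul, Measure.map_smul, hsnd]), hp.map_snd] }

/-- `p` is the density of a coupling of `μ` and `ν` of finite cost and finite entropy that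
minimises the entropy regularised cost among all such couplings. -/
structure IsMinDensity (ε : ℝ) (c : X × Y → ℝ) (μ : Measure X) (ν : Measure Y)
    (p : X × Y → ℝ) : Prop where
  hasMarginals : HasMarginals μ ν p
  integrable_cost : Integrable (fun z => c z * p z) (μ.prod ν)
  integrable_klFun : Integrable (fun z => klFun (p z)) (μ.prod ν)
  le : ∀ q, HasMarginals μ ν q → Integrable (fun z => c z * q z) (μ.prod ν) →
    Integrable (fun z => klFun (q z)) (μ.prod ν) →
    ∫ z, (c z * p z + ε * klFun (p z)) ∂(μ.prod ν) ≤ ∫ z, (c z * q z + ε * klFun (q z)) ∂(μ.prod ν)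

lemma klFun_convexComb_le {a b s t : ℝ} (ha : 0 ≤ a) (hb : 0 ≤ b) (hs : 0 ≤ s) (ht : 0 ≤ t)
    (hst : s + t = 1) : klFun (s * a + t * b) ≤ s * klFun a + t * klFun b :=
  convexOn_klFun.2 ha hb hs ht hst

lemma integrable_klFun_convexComb {P : Measure (X × Y)} (hpm : Measurable p) (hqm : Measurable q)
    (hp0 : ∀ z, 0 ≤ p z) (hq0 : ∀ z, 0 ≤ q z)
    (hp : Integrable (fun z => klFun (p z)) P) (hq : Integrable (fun z => klFun (q z)) P)
    {s t : ℝ} (hs : 0 ≤ s) (ht : 0 ≤ t) (hst : s + t = 1) :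
    Integrable (fun z => klFun (s * p z + t * q z)) P := by
  refine ((hp.const_mul s).add (hq.const_mul t)).mono'
    (measurable_klFun.comp (by fun_prop)).aestronglyMeasurable
    (Filter.Eventually.of_forall fun z => ?_)
  have h0 : 0 ≤ s * p z + t * q z :=
    add_nonneg (mul_nonneg hs (hp0 z)) (mul_nonneg ht (hq0 z))
  rw [Real.norm_of_nonneg (klFun_nonneg h0)]
  exact klFun_convexComb_le (hp0 z) (hq0 z) hs ht hst

/-- Strict convexity of the entropy makes the minimising density unique. -/
lemma IsMinDensity.ae_eq (hε : 0 < ε) (hp : IsMinDensity ε c μ ν p) (hq : IsMinDensity ε c μ ν q) :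
    p =ᵐ[μ.prod ν] q := by
  have h12 : (0 : ℝ) ≤ 1 / 2 := by norm_num
  have hm := hp.hasMarginals.convexComb hq.hasMarginals h12 h12 (by norm_num)
  have hpq := hp.le q hq.hasMarginals hq.integrable_cost hq.integrable_klFun
  have hqp := hq.le p hp.hasMarginals hp.integrable_cost hp.integrable_klFun
  have hcm : Integrable (fun z => c z * (1 / 2 * p z + 1 / 2 * q z)) (μ.prod ν) := by
    refine ((hp.integrable_cost.const_mul (1 / 2)).add
      (hq.integrable_cost.const_mul (1 / 2))).congr (Filter.Eventually.of_forall fun z => ?_)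
    simp only [Pi.add_apply]; ring
  have hkm := integrable_klFun_convexComb hp.hasMarginals.measurable hq.hasMarginals.measurable
    hp.hasMarginals.nonneg hq.hasMarginals.nonneg hp.integrable_klFun hq.integrable_klFun
    h12 h12 (by norm_num)
  have hpm := hp.le _ hm hcm hkm
  set D : X × Y → ℝ := fun z => 1 / 2 * klFun (p z) + 1 / 2 * klFun (q z) -
    klFun (1 / 2 * p z + 1 / 2 * q z) with hD
  have hkpq : Integrable (fun z => 1 / 2 * klFun (p z) + 1 / 2 * klFun (q z)) (μ.prod ν) :=
    (hp.integrable_klFun.const_mul _).add (hq.integrable_klFun.const_mul _)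
  have hD0 : 0 ≤ D := fun z => sub_nonneg.2 (klFun_convexComb_le (hp.hasMarginals.nonneg z)
    (hq.hasMarginals.nonneg z) h12 h12 (by norm_num))
  have hDi : Integrable D (μ.prod ν) := hkpq.sub hkm
  have hsum : ∀ r : X × Y → ℝ, Integrable (fun z => c z * r z) (μ.prod ν) →
      Integrable (fun z => klFun (r z)) (μ.prod ν) →
      ∫ z, (c z * r z + ε * klFun (r z)) ∂(μ.prod ν) =
        ∫ z, c z * r z ∂(μ.prod ν) + ε * ∫ z, klFun (r z) ∂(μ.prod ν) := fun r h1 h2 => by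
    rw [integral_add h1 (h2.const_mul ε), integral_const_mul]
  have hDint : ∫ z, D z ∂(μ.prod ν) = 0 := by
    refine le_antisymm ?_ (integral_nonneg hD0)
    have e1 : ∫ z, D z ∂(μ.prod ν) = 1 / 2 * ∫ z, klFun (p z) ∂(μ.prod ν) +
        1 / 2 * ∫ z, klFun (q z) ∂(μ.prod ν) -
        ∫ z, klFun (1 / 2 * p z + 1 / 2 * q z) ∂(μ.prod ν) := by
      rw [integral_sub hkpq hkm, integral_add (hp.integrable_klFun.const_mul _)
        (hq.integrable_klFun.const_mul _), integral_const_mul, integral_const_mul]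
    have e2 : ∫ z, c z * (1 / 2 * p z + 1 / 2 * q z) ∂(μ.prod ν) =
        1 / 2 * ∫ z, c z * p z ∂(μ.prod ν) + 1 / 2 * ∫ z, c z * q z ∂(μ.prod ν) := by
      rw [← integral_const_mul, ← integral_const_mul, ← integral_add
        (hp.integrable_cost.const_mul _) (hq.integrable_cost.const_mul _)]
      congr 1; funext z; ring
    rw [hsum _ hp.integrable_cost hp.integrable_klFun,
      hsum _ hq.integrable_cost hq.integrable_klFun] at hpq hqp
    rw [hsum _ hp.integrable_cost hp.integrable_klFun, hsum _ hcm hkm, e2] at hpm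
    rw [e1]
    have : ε * (1 / 2 * ∫ z, klFun (p z) ∂(μ.prod ν) + 1 / 2 * ∫ z, klFun (q z) ∂(μ.prod ν) -
        ∫ z, klFun (1 / 2 * p z + 1 / 2 * q z) ∂(μ.prod ν)) ≤ 0 := by nlinarith
    exact nonpos_of_mul_nonpos_right this hε
  filter_upwards [(integral_eq_zero_iff_of_nonneg hD0 hDi).1 hDint] with z hz
  by_contra hne
  have h12' : (0 : ℝ) < 1 / 2 := by norm_num
  have := strictConvexOn_klFun.2 (hp.hasMarginals.nonneg z) (hq.hasMarginals.nonneg z) hne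
    h12' h12' (by norm_num)
  simp only [hD, Pi.zero_apply, smul_eq_mul] at hz this
  linarith

/-- The minimising density does not vanish: mixing it with the product coupling would gain
an entropy of order `t log t` on its zero set, at a cost of order `t`. -/
lemma IsMinDensity.ae_pos [IsProbabilityMeasure μ] [IsProbabilityMeasure ν] (hε : 0 < ε)
    (hc0 : ∀ z, 0 ≤ c z) (hc : Integrable c (μ.prod ν)) (hp : IsMinDensity ε c μ ν p) :
    ∀ᵐ z ∂(μ.prod ν), 0 < p z := by
  have hpm := hp.hasMarginals.measurable
  have hp0 := hp.hasMarginals.nonneg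
  set N : Set (X × Y) := {z | p z = 0} with hN
  have hNm : MeasurableSet N := hpm (measurableSet_singleton 0)
  have key : ∀ n : ℕ, n * (ε * (μ.prod ν).real N) ≤ ∫ z, c z ∂(μ.prod ν) := by
    intro n
    rcases Nat.eq_zero_or_pos n with rfl | hn
    · simpa using integral_nonneg hc0
    -- With weight `t = exp (-n)` on the product coupling the gain in entropy on `N` is `n t`.
    set t : ℝ := Real.exp (-n) with ht
    have ht0 : 0 < t := Real.exp_pos _
    have ht1 : t < 1 := by rw [ht, Real.exp_lt_one_iff]; simpa using hn
    have hq := hp.hasMarginals.convexComb (hasMarginals_one (μ := μ) (ν := ν))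
      (s := 1 - t) (t := t) (by linarith) ht0.le (by ring)
    have hcq : Integrable (fun z => c z * ((1 - t) * p z + t * 1)) (μ.prod ν) := by
      refine ((hp.integrable_cost.const_mul (1 - t)).add (hc.const_mul t)).congr
        (Filter.Eventually.of_forall fun z => ?_)
      simp only [Pi.add_apply]; ring
    have hkq : Integrable (fun z => klFun ((1 - t) * p z + t * 1)) (μ.prod ν) :=
      integrable_klFun_convexComb (q := fun _ => 1) hpm measurable_const hp0
        (fun _ => zero_le_one) hp.integrable_klFun (by simp) (by linarith) ht0.le (by ring)
    have hle := hp.le _ hq hcq hkq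
    have hbound : ∀ z, c z * ((1 - t) * p z + t * 1) + ε * klFun ((1 - t) * p z + t * 1) ≤
        c z * p z + ε * klFun (p z) + t * c z + N.indicator (fun _ => ε * (t * -n)) z := by
      intro z
      have h1 : c z * ((1 - t) * p z + t * 1) ≤ c z * p z + t * c z := by
        nlinarith [mul_nonneg (mul_nonneg ht0.le (hc0 z)) (hp0 z)]
      by_cases hz : z ∈ N
      · have hz' : p z = 0 := hz
        rw [Set.indicator_of_mem hz, hz']
        simp only [klFun, mul_zero, zero_add, mul_one, sub_zero]
        rw [hz'] at h1
        rw [show Real.log t = -n by rw [ht, Real.log_exp]]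
        nlinarith
      · rw [Set.indicator_of_notMem hz]
        have h2 : klFun ((1 - t) * p z + t * 1) ≤ klFun (p z) := by
          have := klFun_convexComb_le (hp0 z) zero_le_one (s := 1 - t) (t := t) (by linarith)
            ht0.le (by ring)
          rw [klFun_one] at this
          nlinarith [klFun_nonneg (hp0 z)]
        nlinarith
    have hI1 : Integrable (fun z => c z * p z + ε * klFun (p z)) (μ.prod ν) :=
      hp.integrable_cost.add (hp.integrable_klFun.const_mul ε)
    have hI2 : Integrable (fun z => c z * p z + ε * klFun (p z) + t * c z) (μ.prod ν) :=
      hI1.add (hc.const_mul t)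
    have hI3 : Integrable (N.indicator fun _ => ε * (t * -n)) (μ.prod ν) :=
      (integrable_const _).indicator hNm
    have hle2 := integral_mono (hcq.add (hkq.const_mul ε)) (hI2.add hI3) hbound
    simp only [Pi.add_apply] at hle2
    rw [integral_add hI2 hI3, integral_add hI1 (hc.const_mul t), integral_const_mul,
      integral_indicator hNm, setIntegral_const, smul_eq_mul] at hle2
    have : 0 ≤ t * (∫ z, c z ∂(μ.prod ν) - n * (ε * (μ.prod ν).real N)) := by
      nlinarith [hle.trans hle2]
    linarith [nonneg_of_mul_nonneg_right this ht0]
  have hzero : (μ.prod ν).real N = 0 := by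
    by_contra hne
    have hpos : 0 < ε * (μ.prod ν).real N :=
      mul_pos hε (lt_of_le_of_ne measureReal_nonneg (Ne.symm hne))
    obtain ⟨n, hn⟩ := exists_nat_gt ((∫ z, c z ∂(μ.prod ν)) / (ε * (μ.prod ν).real N))
    rw [div_lt_iff₀ hpos] at hn
    exact absurd (key n) (not_le.2 hn)
  have hN0 : (μ.prod ν) N = 0 := by
    rwa [measureReal_eq_zero_iff] at hzero
  filter_upwards [measure_eq_zero_iff_ae_notMem.1 hN0] with z hz
  exact lt_of_le_of_ne (hp0 z) fun h => hz h.symm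

lemma IsMinDensity.integrable_mul_log [IsProbabilityMeasure μ]
    [IsProbabilityMeasure ν] (hp : IsMinDensity ε c μ ν p) :
    Integrable (fun z => p z * Real.log (p z)) (μ.prod ν) := by
  refine ((hp.integrable_klFun.sub (integrable_const 1)).add
    hp.hasMarginals.integrable).congr (Filter.Eventually.of_forall fun z => ?_)
  simp only [Pi.add_apply, Pi.sub_apply, klFun]
  ring

/-- The first variation `c + ε log p` of the entropy regularised cost is integrable with respect
to the minimiser. -/
lemma IsMinDensity.integrable_firstVariation [IsProbabilityMeasure μ]
    [IsProbabilityMeasure ν] (hp : IsMinDensity ε c μ ν p) :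
    Integrable (fun z => p z * (c z + ε * Real.log (p z))) (μ.prod ν) := by
  refine (hp.integrable_cost.add (hp.integrable_mul_log.const_mul ε)).congr
    (Filter.Eventually.of_forall fun z => ?_)
  simp only [Pi.add_apply]
  ring

/-- First order optimality: two parts of the minimiser with the same marginals have the same
first variation. -/
lemma IsMinDensity.integral_firstVariation_eq [IsProbabilityMeasure μ]
    [IsProbabilityMeasure ν] (hε : 0 < ε)
    (hp : IsMinDensity ε c μ ν p) {κ₁ κ₂ : Measure (X × Y)}
    (h₁ : κ₁ ≤ ofDensity (μ.prod ν) p) (h₂ : κ₂ ≤ ofDensity (μ.prod ν) p)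
    (hfst : κ₁.map Prod.fst = κ₂.map Prod.fst) (hsnd : κ₁.map Prod.snd = κ₂.map Prod.snd) :
    ∫ z, (c z + ε * Real.log (p z)) ∂κ₁ = ∫ z, (c z + ε * Real.log (p z)) ∂κ₂ := by
  have hpm := hp.hasMarginals.measurable
  have hp0 := hp.hasMarginals.nonneg
  have := hp.hasMarginals.isProbabilityMeasure
  suffices H : ∀ {κ₁ κ₂ : Measure (X × Y)}, κ₁ ≤ ofDensity (μ.prod ν) p →
      κ₂ ≤ ofDensity (μ.prod ν) p → κ₁.map Prod.fst = κ₂.map Prod.fst →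
      κ₁.map Prod.snd = κ₂.map Prod.snd →
      ∫ z, (c z + ε * Real.log (p z)) ∂κ₂ ≤ ∫ z, (c z + ε * Real.log (p z)) ∂κ₁ from
    le_antisymm (H h₂ h₁ hfst.symm hsnd.symm) (H h₁ h₂ hfst hsnd)
  intro κ₁ κ₂ h₁ h₂ hfst hsnd
  obtain ⟨r₁, hr₁, hr₁0, hr₁1, rfl⟩ := exists_ofDensity_of_le h₁
  obtain ⟨r₂, hr₂, hr₂0, hr₂1, rfl⟩ := exists_ofDensity_of_le h₂
  rw [← ofDensity_mul hpm hp0 hr₁, ← ofDensity_mul hpm hp0 hr₂] at hfst hsnd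
  set A : X × Y → ℝ := fun z => c z + ε * Real.log (p z) with hA
  have hAi : Integrable (fun z => p z * A z) (μ.prod ν) := hp.integrable_firstVariation
  have hAr : ∀ r : X × Y → ℝ, Measurable r → (∀ z, 0 ≤ r z) → (∀ z, r z ≤ 1) →
      Integrable (fun z => r z * (p z * A z)) (μ.prod ν) := fun r hr hr0 hr1 =>
    hAi.bdd_mul (c := 1) hr.aestronglyMeasurable (Filter.Eventually.of_forall fun z => by
      rw [Real.norm_of_nonneg (hr0 z)]; exact hr1 z)
  have hrep : ∀ r : X × Y → ℝ, Measurable r → (∀ z, 0 ≤ r z) →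
      ∫ z, A z ∂(ofDensity (ofDensity (μ.prod ν) p) r) =
        ∫ z, r z * (p z * A z) ∂(μ.prod ν) := fun r hr hr0 => by
    rw [← ofDensity_mul hpm hp0 hr, integral_ofDensity (by fun_prop)
      (fun z => mul_nonneg (hp0 z) (hr0 z))]
    congr 1; funext z; simp only [smul_eq_mul]; ring
  change ∫ z, A z ∂_ ≤ ∫ z, A z ∂_
  rw [hrep _ hr₁ hr₁0, hrep _ hr₂ hr₂0]
  set I₁ := ∫ z, r₁ z * (p z * A z) ∂(μ.prod ν)
  set I₂ := ∫ z, r₂ z * (p z * A z) ∂(μ.prod ν)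
  -- Compare with the coupling whose density relative to the minimiser is `1 + t (r₁ - r₂)`.
  have key : ∀ t : ℝ, 0 < t → t < 1 → 0 ≤ I₁ - I₂ + ε * t := by
    intro t ht ht1
    have hq := hp.hasMarginals.exchange hr₁ hr₁0 hr₁1 hr₂ hr₂0 hr₂1 hfst hsnd ht.le ht1.le
    have hs : ∀ z, |r₁ z - r₂ z| ≤ 1 := fun z => abs_sub_le_iff.2
      ⟨by linarith [hr₁1 z, hr₂0 z], by linarith [hr₂1 z, hr₁0 z]⟩
    have hs' : ∀ z, -1 < t * (r₁ z - r₂ z) := fun z => by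
      have := (abs_le.1 (hs z)).1; nlinarith
    have hs2 : ∀ z, (t * (r₁ z - r₂ z)) ^ 2 ≤ t ^ 2 := fun z => by
      rw [mul_pow]
      have : (r₁ z - r₂ z) ^ 2 ≤ 1 := (sq_le_one_iff_abs_le_one _).2 (hs z)
      nlinarith [sq_nonneg t]
    have hcq : Integrable (fun z => c z * (p z * (1 + t * (r₁ z - r₂ z)))) (μ.prod ν) := by
      have := hp.integrable_cost.bdd_mul (c := 2) (f := fun z => 1 + t * (r₁ z - r₂ z))
        (by fun_prop) (Filter.Eventually.of_forall fun z => by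
          have := abs_le.1 (hs z)
          rw [Real.norm_eq_abs, abs_le]
          constructor <;> nlinarith)
      refine this.congr (Filter.Eventually.of_forall fun z => ?_)
      simp only; ring
    set T : X × Y → ℝ := fun z => t * (r₁ z - r₂ z) with hT
    have hTlog : Integrable (fun z => T z * (p z * Real.log (p z))) (μ.prod ν) :=
      hp.integrable_mul_log.bdd_mul (c := 1) (by fun_prop) (Filter.Eventually.of_forall fun z => by
        have := abs_le.1 (hs z)
        rw [Real.norm_eq_abs, abs_le, hT]
        constructor <;> nlinarith)
    have hkb : ∀ z, klFun (p z * (1 + T z)) ≤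
        klFun (p z) + T z * (p z * Real.log (p z)) + t ^ 2 * p z := fun z => by
      have := klFun_mul_one_add_le (hp0 z) (hs' z)
      nlinarith [mul_le_mul_of_nonneg_left (hs2 z) (hp0 z)]
    have hkq : Integrable (fun z => klFun (p z * (1 + T z))) (μ.prod ν) := by
      refine ((hp.integrable_klFun.add hTlog).add
        (hp.hasMarginals.integrable.const_mul (t ^ 2))).mono'
        (measurable_klFun.comp (by fun_prop)).aestronglyMeasurable
        (Filter.Eventually.of_forall fun z => ?_)
      rw [Real.norm_of_nonneg (klFun_nonneg (hq.nonneg z))]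
      exact hkb z
    have hle := hp.le _ hq hcq hkq
    have hI1 : Integrable (fun z => c z * p z + ε * klFun (p z)) (μ.prod ν) :=
      hp.integrable_cost.add (hp.integrable_klFun.const_mul ε)
    have hi₁ := hAr r₁ hr₁ hr₁0 hr₁1
    have hi₂ := hAr r₂ hr₂ hr₂0 hr₂1
    have hle2 := integral_mono (hcq.add (hkq.const_mul ε))
      ((hI1.add ((hi₁.sub hi₂).const_mul t)).add
        (hp.hasMarginals.integrable.const_mul (ε * t ^ 2))) (fun z => by
      simp only [Pi.add_apply, Pi.sub_apply]
      have := mul_le_mul_of_nonneg_left (hkb z) hε.le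
      simp only [hT, hA] at this ⊢
      linarith)
    rw [integral_add' (hI1.add ((hi₁.sub hi₂).const_mul t))
        (hp.hasMarginals.integrable.const_mul (ε * t ^ 2)),
      integral_add' hI1 ((hi₁.sub hi₂).const_mul t), integral_const_mul, integral_const_mul,
      integral_sub' hi₁ hi₂, hp.hasMarginals.integral_eq_one] at hle2
    have : 0 ≤ t * (I₁ - I₂ + ε * t) := by
      simp only [Pi.add_apply] at hle2
      linarith [hle.trans hle2]
    exact nonneg_of_mul_nonneg_right this ht
  -- A small `t` contradicts `I₁ < I₂`.
  by_contra hlt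
  rw [not_le] at hlt
  have h1 := key (min (1 / 2) ((I₂ - I₁) / (2 * ε))) (lt_min (by norm_num)
    (div_pos (by linarith) (by linarith))) (lt_of_le_of_lt (min_le_left _ _) (by norm_num))
  have h2 : ε * min (1 / 2) ((I₂ - I₁) / (2 * ε)) ≤ (I₂ - I₁) / 2 := by
    calc _ ≤ ε * ((I₂ - I₁) / (2 * ε)) := by gcongr; exact min_le_right _ _
      _ = _ := by field_simp
  linarith

end Minimal

/-! ### The minimising density is a Gibbs density -/

section Splitting

variable {X Y : Type*} [MeasurableSpace X] [MeasurableSpace Y] {μ : Measure X} {ν : Measure Y}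
  {p c : X × Y → ℝ} {ε : ℝ}

lemma map_ofDensity_le {Ω Ω' : Type*} [MeasurableSpace Ω] [MeasurableSpace Ω'] {M : Measure Ω}
    {P : Measure Ω'} {e : Ω → Ω'} (he : MeasurePreserving e M P) {w : Ω → ℝ} {h : Ω' → ℝ}
    (hh : Measurable h) (hwh : ∀ m, w m ≤ h (e m)) :
    (ofDensity M w).map e ≤ ofDensity P h := by
  refine Measure.le_iff.2 fun s hs => ?_
  rw [Measure.map_apply he.measurable hs, ofDensity, ofDensity,
    withDensity_apply _ (he.measurable hs), withDensity_apply _ hs, ← he.map_eq,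
    setLIntegral_map hs hh.ennreal_ofReal he.measurable]
  exact lintegral_mono fun m => ENNReal.ofReal_le_ofReal (hwh m)

/-- The first variation of the minimiser satisfies the four-point identity
`A(u, x) + A(u', x') = A(u, x') + A(u', x)` almost everywhere. Otherwise some mass of the minimiser
near `(u, x)` and `(u', x')` could be exchanged for mass near `(u, x')` and `(u', x)`. -/
lemma IsMinDensity.ae_fourPoint [IsProbabilityMeasure μ] [IsProbabilityMeasure ν] (hε : 0 < ε)
    (hcm : Measurable c) (hc0 : ∀ z, 0 ≤ c z) (hc : Integrable c (μ.prod ν))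
    (hp : IsMinDensity ε c μ ν p) {A : X × Y → ℝ} (hA : A = fun z => c z + ε * Real.log (p z)) :
    ∀ᵐ m ∂((μ.prod ν).prod (μ.prod ν)), A m.1 + A m.2 = A (m.1.1, m.2.2) + A (m.2.1, m.1.2) := by
  have hpm := hp.hasMarginals.measurable
  have hp0 := hp.hasMarginals.nonneg
  have hAm : Measurable A := by rw [hA]; fun_prop
  set P := μ.prod ν with hP
  set M := P.prod P with hM
  set e₃ : (X × Y) × (X × Y) → X × Y := fun m => (m.1.1, m.2.2) with he₃
  set e₄ : (X × Y) × (X × Y) → X × Y := fun m => (m.2.1, m.1.2) with he₄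
  have mp₁ : MeasurePreserving Prod.fst M P := measurePreserving_fst
  have mp₂ : MeasurePreserving Prod.snd M P := measurePreserving_snd
  have mp₃ : MeasurePreserving e₃ M P :=
    MeasurePreserving.prod (measurePreserving_fst (μ := μ) (ν := ν))
      (measurePreserving_snd (μ := μ) (ν := ν))
  have mp₄ : MeasurePreserving e₄ M P := mp₃.comp Measure.measurePreserving_swap
  set B : (X × Y) × (X × Y) → ℝ := fun m => A m.1 + A m.2 - (A (e₃ m) + A (e₄ m)) with hB
  have hBm : Measurable B := by
    have := mp₃.measurable; have := mp₄.measurable; fun_prop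
  -- The factor `1 / 2` lets the mass at two opposite corners add up to at most `p`.
  set w : (X × Y) × (X × Y) → ℝ := fun m =>
    1 / 2 * min (min (p m.1) (p m.2)) (min (p (e₃ m)) (p (e₄ m))) with hw
  have hwm : Measurable w := by
    have := mp₃.measurable; have := mp₄.measurable; fun_prop
  have hw0 : ∀ m, 0 ≤ w m := fun m => mul_nonneg (by norm_num)
    (le_min (le_min (hp0 _) (hp0 _)) (le_min (hp0 _) (hp0 _)))
  have hwpos : ∀ᵐ m ∂M, 0 < w m := by
    have hpos := hp.ae_pos hε hc0 hc
    filter_upwards [mp₁.quasiMeasurePreserving.ae hpos, mp₂.quasiMeasurePreserving.ae hpos,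
      mp₃.quasiMeasurePreserving.ae hpos, mp₄.quasiMeasurePreserving.ae hpos] with m h1 h2 h3 h4
    exact mul_pos (by norm_num) (lt_min (lt_min h1 h2) (lt_min h3 h4))
  have hhalf : ofDensity P (fun z => 1 / 2 * p z) + ofDensity P (fun z => 1 / 2 * p z) =
      ofDensity P p := by
    have h0 : ∀ z, 0 ≤ 1 / 2 * p z := fun z => mul_nonneg (by norm_num) (hp0 z)
    rw [← ofDensity_add (by fun_prop) h0 h0]
    congr 1; funext z; ring
  have hAπ : Integrable A (ofDensity P p) := by
    rw [integrable_ofDensity_iff hpm hp0, hA]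
    exact hp.integrable_firstVariation
  have hzero : ∀ S : Set ((X × Y) × (X × Y)), MeasurableSet S →
      Integrable (fun m => S.indicator w m * B m) M ∧ ∫ m, S.indicator w m * B m ∂M = 0 := by
    intro S hS
    have hwS : ∀ m, S.indicator w m ≤ w m := fun m => Set.indicator_le_self' (fun m _ => hw0 m) m
    have hwSm : Measurable (S.indicator w) := hwm.indicator hS
    have hwS0 : ∀ m, 0 ≤ S.indicator w m := fun m => Set.indicator_nonneg (fun m _ => hw0 m) m
    set W := ofDensity M (S.indicator w) with hW
    have hh : Measurable fun z => 1 / 2 * p z := by fun_prop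
    have l₁ : W.map Prod.fst ≤ ofDensity P (fun z => 1 / 2 * p z) :=
      map_ofDensity_le mp₁ hh fun m => (hwS m).trans (mul_le_mul_of_nonneg_left
        ((min_le_left _ _).trans (min_le_left _ _)) (by norm_num))
    have l₂ : W.map Prod.snd ≤ ofDensity P (fun z => 1 / 2 * p z) :=
      map_ofDensity_le mp₂ hh fun m => (hwS m).trans (mul_le_mul_of_nonneg_left
        ((min_le_left _ _).trans (min_le_right _ _)) (by norm_num))
    have l₃ : W.map e₃ ≤ ofDensity P (fun z => 1 / 2 * p z) :=
      map_ofDensity_le mp₃ hh fun m => (hwS m).trans (mul_le_mul_of_nonneg_left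
        ((min_le_right _ _).trans (min_le_left _ _)) (by norm_num))
    have l₄ : W.map e₄ ≤ ofDensity P (fun z => 1 / 2 * p z) :=
      map_ofDensity_le mp₄ hh fun m => (hwS m).trans (mul_le_mul_of_nonneg_left
        ((min_le_right _ _).trans (min_le_right _ _)) (by norm_num))
    have hle : ofDensity P (fun z => 1 / 2 * p z) ≤ ofDensity P p := by
      rw [← hhalf]; exact Measure.le_add_right le_rfl
    have i₁ := hAπ.mono_measure (l₁.trans hle)
    have i₂ := hAπ.mono_measure (l₂.trans hle)
    have i₃ := hAπ.mono_measure (l₃.trans hle)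
    have i₄ := hAπ.mono_measure (l₄.trans hle)
    have key := hp.integral_firstVariation_eq hε
      (κ₁ := W.map Prod.fst + W.map Prod.snd) (κ₂ := W.map e₃ + W.map e₄)
      ((add_le_add l₁ l₂).trans hhalf.le) ((add_le_add l₃ l₄).trans hhalf.le)
      (by
        rw [Measure.map_add _ _ measurable_fst, Measure.map_add _ _ measurable_fst,
          Measure.map_map measurable_fst mp₁.measurable,
          Measure.map_map measurable_fst mp₂.measurable,
          Measure.map_map measurable_fst mp₃.measurable,
          Measure.map_map measurable_fst mp₄.measurable]
        rfl)
      (by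
        rw [Measure.map_add _ _ measurable_snd, Measure.map_add _ _ measurable_snd,
          Measure.map_map measurable_snd mp₁.measurable,
          Measure.map_map measurable_snd mp₂.measurable,
          Measure.map_map measurable_snd mp₃.measurable,
          Measure.map_map measurable_snd mp₄.measurable, add_comm]
        rfl)
    rw [← hA, integral_add_measure i₁ i₂, integral_add_measure i₃ i₄,
      integral_map mp₁.measurable.aemeasurable hAm.aestronglyMeasurable,
      integral_map mp₂.measurable.aemeasurable hAm.aestronglyMeasurable,
      integral_map mp₃.measurable.aemeasurable hAm.aestronglyMeasurable,
      integral_map mp₄.measurable.aemeasurable hAm.aestronglyMeasurable] at key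
    have j₁ : Integrable (fun m => A m.1) W := i₁.comp_measurable mp₁.measurable
    have j₂ : Integrable (fun m => A m.2) W := i₂.comp_measurable mp₂.measurable
    have j₃ : Integrable (fun m => A (e₃ m)) W := i₃.comp_measurable mp₃.measurable
    have j₄ : Integrable (fun m => A (e₄ m)) W := i₄.comp_measurable mp₄.measurable
    have hBW : Integrable B W := (j₁.add j₂).sub (j₃.add j₄)
    refine ⟨(integrable_ofDensity_iff hwSm hwS0).1 hBW, ?_⟩
    have hint : ∫ m, B m ∂W = 0 := by
      have h1 := integral_sub (j₁.add j₂) (j₃.add j₄)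
      simp only [Pi.add_apply] at h1
      rw [integral_add j₁ j₂, integral_add j₃ j₄] at h1
      rw [hB, h1, key, sub_self]
    rw [hW, integral_ofDensity hwSm hwS0] at hint
    simpa using hint
  -- Taking for `S` the sets where `B` is positive and negative forces `B = 0`.
  have hpos := hzero {m | 0 < B m} (measurableSet_lt measurable_const hBm)
  have hneg := hzero {m | B m < 0} (measurableSet_lt hBm measurable_const)
  have h1 := (integral_eq_zero_iff_of_nonneg (fun m => by
    by_cases hm : m ∈ {m | 0 < B m}
    · simp only [Set.indicator_of_mem hm]; exact mul_nonneg (hw0 m) (le_of_lt hm)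
    · simp [Set.indicator_of_notMem hm]) hpos.1).1 hpos.2
  have h2 := (integral_eq_zero_iff_of_nonneg (f := fun m => -({m | B m < 0}.indicator w m * B m))
    (fun m => by
      by_cases hm : m ∈ {m | B m < 0}
      · simp only [Set.indicator_of_mem hm]
        exact neg_nonneg.2 (mul_nonpos_of_nonneg_of_nonpos (hw0 m) (le_of_lt hm))
      · simp [Set.indicator_of_notMem hm]) hneg.1.neg).1
    (by rw [integral_neg, hneg.2, neg_zero])
  filter_upwards [h1, h2, hwpos] with m h1 h2 h3
  have hB0 : B m = 0 := by
    rcases lt_trichotomy (B m) 0 with h | h | h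
    · simp only [Set.indicator_of_mem (show m ∈ {m | B m < 0} from h), Pi.zero_apply] at h2
      nlinarith
    · exact h
    · simp only [Set.indicator_of_mem (show m ∈ {m | 0 < B m} from h), Pi.zero_apply] at h1
      nlinarith
  exact sub_eq_zero.1 hB0

/-- The minimising density is the exponential of a sum of potentials minus the cost. -/
lemma IsMinDensity.exists_potentials [IsProbabilityMeasure μ] [IsProbabilityMeasure ν]
    (hε : 0 < ε) (hcm : Measurable c) (hc0 : ∀ z, 0 ≤ c z) (hc : Integrable c (μ.prod ν))
    (hp : IsMinDensity ε c μ ν p) :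
    ∃ (φ : X → ℝ) (ψ : Y → ℝ), Measurable φ ∧ Measurable ψ ∧
      p =ᵐ[μ.prod ν] fun z => Real.exp ((φ z.1 + ψ z.2 - c z) / ε) := by
  have hpm := hp.hasMarginals.measurable
  set A : X × Y → ℝ := fun z => c z + ε * Real.log (p z) with hA
  have hAm : Measurable A := by fun_prop
  obtain ⟨z₀, hz₀⟩ := (Measure.ae_ae_of_ae_prod (hp.ae_fourPoint hε hcm hc0 hc hA)).exists
  refine ⟨fun u => A (u, z₀.2) - A z₀, fun x => A (z₀.1, x), by fun_prop, by fun_prop, ?_⟩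
  filter_upwards [hz₀, hp.ae_pos hε hc0 hc] with z hz hpz
  have : (A (z.1, z₀.2) - A z₀ + A (z₀.1, z.2) - c z) / ε = Real.log (p z) := by
    rw [div_eq_iff hε.ne']
    have h1 : A z = c z + ε * Real.log (p z) := rfl
    linarith
  simp only [this, Real.exp_log hpz]

end Splitting

/-! ### Entropic optimal couplings have minimal densities -/

section Plan

open InformationTheory

variable {d : ℕ} {ε : ℝ} {μ ν : Measure (E d)}

lemma cost_nonneg (u x : E d) : 0 ≤ cost u x := by unfold cost; positivity

lemma measurable_cost : Measurable fun z : E d × E d => cost z.1 z.2 := by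
  unfold cost; fun_prop

lemma IsCoupling.integrable_cost {π : Measure (E d × E d)} (hπ : IsCoupling μ ν π)
    (hμ : MemLp id 2 μ) (hν : MemLp id 2 ν) :
    Integrable (fun z : E d × E d => cost z.1 z.2) π := by
  rw [← hπ.1] at hμ
  rw [← hπ.2] at hν
  have h1 := hμ.comp_of_map measurable_fst.aemeasurable
  have h2 := hν.comp_of_map measurable_snd.aemeasurable
  have h3 := (h1.sub h2).norm.integrable_sq
  simpa [cost] using h3.div_const 2

lemma HasMarginals.isCoupling {q : E d × E d → ℝ} (hq : HasMarginals μ ν q) :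
    IsCoupling μ ν (ofDensity (μ.prod ν) q) := ⟨hq.map_fst, hq.map_snd⟩

lemma klDiv_ofDensity [IsProbabilityMeasure μ] [IsProbabilityMeasure ν] {q : E d × E d → ℝ}
    (hq : HasMarginals μ ν q) :
    klDiv (ofDensity (μ.prod ν) q) (μ.prod ν) =
      ∫⁻ z, ENNReal.ofReal (klFun (q z)) ∂(μ.prod ν) := by
  have := hq.isProbabilityMeasure
  rw [klDiv_eq_lintegral_klFun_of_ac
    (show ofDensity (μ.prod ν) q ≪ μ.prod ν from withDensity_absolutelyContinuous _ _)]
  refine lintegral_congr_ae ?_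
  filter_upwards [Measure.rnDeriv_withDensity (μ.prod ν) hq.measurable.ennreal_ofReal] with z hz
  rw [ofDensity, hz, ENNReal.toReal_ofReal (hq.nonneg z)]

lemma primalObjective_ofDensity [IsProbabilityMeasure μ] [IsProbabilityMeasure ν] (hε : 0 < ε)
    {q : E d × E d → ℝ} (hq : HasMarginals μ ν q)
    (hc : Integrable (fun z => cost z.1 z.2 * q z) (μ.prod ν))
    (hk : Integrable (fun z => klFun (q z)) (μ.prod ν)) :
    primalObjective ε μ ν (ofDensity (μ.prod ν) q) =
      ENNReal.ofReal (∫ z, (cost z.1 z.2 * q z + ε * klFun (q z)) ∂(μ.prod ν)) := by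
  have hk0 : ∀ z, 0 ≤ klFun (q z) := fun z => klFun_nonneg (hq.nonneg z)
  have hc0 : ∀ z : E d × E d, 0 ≤ cost z.1 z.2 * q z := fun z =>
    mul_nonneg (cost_nonneg _ _) (hq.nonneg z)
  have hc' : Integrable (fun z : E d × E d => cost z.1 z.2) (ofDensity (μ.prod ν) q) := by
    rw [integrable_ofDensity_iff hq.measurable hq.nonneg]
    simpa only [smul_eq_mul, mul_comm] using hc
  rw [primalObjective, klDiv_ofDensity hq, integral_add hc (hk.const_mul ε), integral_const_mul,
    ENNReal.ofReal_add (integral_nonneg hc0) (mul_nonneg hε.le (integral_nonneg hk0)),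
    ENNReal.ofReal_mul hε.le, ofReal_integral_eq_lintegral_ofReal hk (ae_of_all _ hk0),
    ← ofReal_integral_eq_lintegral_ofReal hc' (ae_of_all _ fun z => cost_nonneg _ _),
    integral_ofDensity hq.measurable hq.nonneg]
  simp only [smul_eq_mul, mul_comm]

/-- The entropic optimal coupling has a density with respect to the product measure, and that
density is minimal. -/
lemma IsEOTPlan.exists_isMinDensity [IsProbabilityMeasure μ] [IsProbabilityMeasure ν] (hε : 0 < ε)
    (hμ : MemLp id 2 μ) (hν : MemLp id 2 ν) {π : Measure (E d × E d)} (hπ : IsEOTPlan ε μ ν π) :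
    ∃ p, IsMinDensity ε (fun z => cost z.1 z.2) μ ν p ∧ π = ofDensity (μ.prod ν) p := by
  have hprob : IsProbabilityMeasure π := by
    have : IsProbabilityMeasure (π.map Prod.fst) := by rw [hπ.1.1]; infer_instance
    exact Measure.isProbabilityMeasure_of_map Prod.fst
  -- The product coupling has finite value, so the minimal value is finite.
  have hfin : primalObjective ε μ ν π ≠ ∞ := by
    have h1 := hasMarginals_one (μ := μ) (ν := ν)
    refine ne_top_of_le_ne_top ?_ (hπ.2 _ h1.isCoupling)
    have hc := h1.isCoupling.integrable_cost hμ hν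
    rw [integrable_ofDensity_iff h1.measurable h1.nonneg] at hc
    rw [primalObjective_ofDensity hε h1 (by simpa using hc) (by simp)]
    exact ENNReal.ofReal_ne_top
  have hkl : klDiv π (μ.prod ν) ≠ ∞ := by
    intro h
    rw [primalObjective, h, ENNReal.mul_top (by simpa using hε)] at hfin
    simp at hfin
  obtain ⟨hac, hllr⟩ := klDiv_ne_top_iff.1 hkl
  set p : E d × E d → ℝ := fun z => (π.rnDeriv (μ.prod ν) z).toReal with hpdef
  have hπp : π = ofDensity (μ.prod ν) p := by
    conv_lhs => rw [← Measure.withDensity_rnDeriv_eq π (μ.prod ν) hac]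
    refine withDensity_congr_ae ?_
    filter_upwards [Measure.rnDeriv_lt_top π (μ.prod ν)] with z hz
    rw [hpdef, ENNReal.ofReal_toReal hz.ne]
  have hp : HasMarginals μ ν p :=
    { measurable := by fun_prop
      nonneg := fun z => ENNReal.toReal_nonneg
      map_fst := by rw [← hπp, hπ.1.1]
      map_snd := by rw [← hπp, hπ.1.2] }
  have hcost : ∀ q : E d × E d → ℝ, HasMarginals μ ν q →
      Integrable (fun z => cost z.1 z.2 * q z) (μ.prod ν) := fun q hq => by
    have := hq.isCoupling.integrable_cost hμ hν
    rw [integrable_ofDensity_iff hq.measurable hq.nonneg] at this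
    simpa only [smul_eq_mul, mul_comm] using this
  have hk : Integrable (fun z => klFun (p z)) (μ.prod ν) :=
    (integrable_klFun_rnDeriv_iff hac).2 hllr
  refine ⟨p, ⟨hp, hcost p hp, hk, fun q hq hcq hkq => ?_⟩, hπp⟩
  have hle := hπ.2 _ hq.isCoupling
  rw [hπp, primalObjective_ofDensity hε hp (hcost p hp) hk,
    primalObjective_ofDensity hε hq hcq hkq] at hle
  exact (ENNReal.ofReal_le_ofReal_iff (integral_nonneg fun z => add_nonneg
    (mul_nonneg (cost_nonneg _ _) (hq.nonneg z))
    (mul_nonneg hε.le (klFun_nonneg (hq.nonneg z))))).1 hle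

lemma IsEOTPlan.eq [IsProbabilityMeasure μ] [IsProbabilityMeasure ν] (hε : 0 < ε)
    (hμ : MemLp id 2 μ) (hν : MemLp id 2 ν) {π π' : Measure (E d × E d)}
    (hπ : IsEOTPlan ε μ ν π) (hπ' : IsEOTPlan ε μ ν π') : π = π' := by
  obtain ⟨p, hp, rfl⟩ := hπ.exists_isMinDensity hε hμ hν
  obtain ⟨q, hq, rfl⟩ := hπ'.exists_isMinDensity hε hμ hν
  exact ofDensity_congr (hp.ae_eq hε hq)

end Plan

/-! ### The uniform measure on the ball -/

section UniformMeasure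

variable {d : ℕ} {ε : ℝ}

lemma volume_unitBall_ne_zero : (volume (unitBall d)) ≠ 0 :=
  (Metric.measure_ball_pos volume 0 one_pos).ne'

lemma volume_unitBall_ne_top : (volume (unitBall d)) ≠ ∞ := measure_ball_lt_top.ne

instance isProbabilityMeasure_unifBall : IsProbabilityMeasure (unifBall d) :=
  ProbabilityTheory.cond_isProbabilityMeasure_of_finite volume_unitBall_ne_zero
    volume_unitBall_ne_top

lemma ae_unifBall : ae (unifBall d) = ae (volume.restrict (unitBall d)) := by
  rw [unifBall, ProbabilityTheory.cond]
  exact Measure.ae_ennreal_smul_measure_eq (ENNReal.inv_ne_zero.2 volume_unitBall_ne_top) _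

lemma ae_unifBall_mem : ∀ᵐ u ∂(unifBall d), u ∈ unitBall d := by
  rw [ae_unifBall]
  exact ae_restrict_mem measurableSet_ball

lemma memLp_id_unifBall : MemLp id 2 (unifBall d) :=
  MemLp.of_bound aestronglyMeasurable_id 1 (ae_unifBall_mem.mono fun _ hu =>
    (mem_ball_zero_iff.1 hu).le)

lemma eqOn_unitBall_of_ae_eq {F : Type*} [TopologicalSpace F] [T2Space F] {f g : E d → F}
    (hf : ContinuousOn f (unitBall d)) (hg : ContinuousOn g (unitBall d))
    (h : f =ᵐ[unifBall d] g) : Set.EqOn f g (unitBall d) := by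
  refine Measure.eqOn_open_of_ae_eq (μ := volume) ?_ Metric.isOpen_ball hf hg
  rw [Filter.EventuallyEq, ae_unifBall] at h
  exact h

/-- A point of the ball is the midpoint of two points at which a given almost sure property
holds. -/
lemma exists_add_sub_of_ae {q : E d → Prop} (h : ∀ᵐ u ∂(unifBall d), q u) {u : E d}
    (hu : u ∈ unitBall d) : ∃ v, q (u + v) ∧ q (u - v) := by
  rw [ae_unifBall, unitBall, ae_restrict_iff' measurableSet_ball] at h
  have h1 := (measurePreserving_add_left volume u).quasiMeasurePreserving.ae h
  have h2 := (Measure.measurePreserving_sub_left volume u).quasiMeasurePreserving.ae h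
  obtain ⟨r, hr, hball⟩ := Metric.isOpen_iff.1 Metric.isOpen_ball u hu
  have hne : (ae (volume.restrict (Metric.ball (0 : E d) r))).NeBot :=
    ae_restrict_neBot.2 (Metric.measure_ball_pos volume 0 hr).ne'
  obtain ⟨v, h1, h2, hv⟩ := ((ae_restrict_of_ae h1).and ((ae_restrict_of_ae h2).and
    (ae_restrict_mem measurableSet_ball))).exists (f := ae (volume.restrict (Metric.ball 0 r)))
  have hv' : ‖v‖ < r := mem_ball_zero_iff.1 hv
  exact ⟨v, h1 (hball (by simpa using hv')), h2 (hball (by simpa [mem_ball_iff_norm] using hv'))⟩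

end UniformMeasure

/-! ### Schrödinger potentials -/

section Schrodinger

variable {d : ℕ} {ε : ℝ}

/-- The density `exp ((φ(u) + ψ(x) - ‖u - x‖² / 2) / ε)` of the coupling given by a pair of
potentials. -/
noncomputable def gibbs (ε : ℝ) (φ ψ : E d → ℝ) (z : E d × E d) : ℝ :=
  Real.exp ((φ z.1 + ψ z.2 - cost z.1 z.2) / ε)

lemma gibbs_nonneg (φ ψ : E d → ℝ) (z : E d × E d) : 0 ≤ gibbs ε φ ψ z := (Real.exp_pos _).le

lemma measurable_gibbs {φ ψ : E d → ℝ} (hφ : Measurable φ) (hψ : Measurable ψ) :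
    Measurable (gibbs ε φ ψ) := by
  have := measurable_cost (d := d)
  unfold gibbs
  fun_prop

/-- `(φ, ψ)` is a pair of Schrödinger potentials: the Gibbs density is the density of a coupling
of `μ` and `ν`. Unlike for a dual maximiser, no integrability is required. -/
structure IsSchrodinger (ε : ℝ) (μ ν : Measure (E d)) (φ ψ : E d → ℝ) : Prop where
  measurable_left : Measurable φ
  measurable_right : Measurable ψ
  hasMarginals : HasMarginals μ ν (gibbs ε φ ψ)

variable {μ ν : Measure (E d)} {φ ψ φ' ψ' : E d → ℝ}

lemma IsSchrodinger.shift (h : IsSchrodinger ε μ ν φ ψ) (a : ℝ) :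
    IsSchrodinger ε μ ν (fun u => φ u + a) (fun x => ψ x - a) where
  measurable_left := h.measurable_left.add_const a
  measurable_right := h.measurable_right.sub_const a
  hasMarginals := by
    have : gibbs ε (fun u => φ u + a) (fun x => ψ x - a) = gibbs ε φ ψ := by
      funext z
      simp only [gibbs]
      congr 2
      ring
    rw [this]
    exact h.hasMarginals

/-- The entropic optimal coupling is given by Schrödinger potentials. -/
lemma IsEOTPlan.exists_isSchrodinger [IsProbabilityMeasure μ] [IsProbabilityMeasure ν] (hε : 0 < ε)
    (hμ : MemLp id 2 μ) (hν : MemLp id 2 ν) {π : Measure (E d × E d)} (hπ : IsEOTPlan ε μ ν π) :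
    ∃ φ ψ, IsSchrodinger ε μ ν φ ψ ∧ π = ofDensity (μ.prod ν) (gibbs ε φ ψ) := by
  obtain ⟨p, hp, rfl⟩ := hπ.exists_isMinDensity hε hμ hν
  have hc : Integrable (fun z : E d × E d => cost z.1 z.2) (μ.prod ν) :=
    IsCoupling.integrable_cost ⟨by simp [Measure.map_fst_prod], by simp [Measure.map_snd_prod]⟩
      hμ hν
  obtain ⟨φ, ψ, hφ, hψ, hpe⟩ := hp.exists_potentials hε measurable_cost
    (fun z => cost_nonneg _ _) hc
  have he : ofDensity (μ.prod ν) p = ofDensity (μ.prod ν) (gibbs ε φ ψ) := ofDensity_congr hpe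
  exact ⟨φ, ψ, ⟨hφ, hψ, measurable_gibbs hφ hψ, gibbs_nonneg φ ψ,
    by rw [← he, hp.hasMarginals.map_fst], by rw [← he, hp.hasMarginals.map_snd]⟩, he⟩

lemma dualObjective_congr [SFinite μ] [SFinite ν] (hφ : φ =ᵐ[μ] φ') (hψ : ψ =ᵐ[ν] ψ') :
    dualObjective ε μ ν φ ψ = dualObjective ε μ ν φ' ψ' := by
  have h : ∀ᵐ z ∂(μ.prod ν), ENNReal.ofReal (Real.exp ((φ z.1 + ψ z.2 - cost z.1 z.2) / ε)) =
      ENNReal.ofReal (Real.exp ((φ' z.1 + ψ' z.2 - cost z.1 z.2) / ε)) := by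
    filter_upwards [Measure.quasiMeasurePreserving_fst.ae hφ,
      Measure.quasiMeasurePreserving_snd.ae hψ] with z h1 h2
    rw [h1, h2]
  rw [dualObjective, dualObjective, integral_congr_ae hφ, integral_congr_ae hψ,
    lintegral_congr_ae h]

lemma dualObjective_eq_coe (hε : 0 < ε) (h : Integrable (gibbs ε φ ψ) (μ.prod ν)) :
    dualObjective ε μ ν φ ψ = (((∫ u, φ u ∂μ) + (∫ x, ψ x ∂ν) + ε -
      ε * ∫ z, gibbs ε φ ψ z ∂(μ.prod ν) : ℝ) : EReal) := by
  have h1 : ∫⁻ z, ENNReal.ofReal (Real.exp ((φ z.1 + ψ z.2 - cost z.1 z.2) / ε)) ∂(μ.prod ν) =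
      ENNReal.ofReal (∫ z, gibbs ε φ ψ z ∂(μ.prod ν)) :=
    (ofReal_integral_eq_lintegral_ofReal h (ae_of_all _ (gibbs_nonneg φ ψ))).symm
  rw [dualObjective, h1, ← ENNReal.ofReal_mul hε.le, EReal.coe_ennreal_ofReal,
    max_eq_left (mul_nonneg hε.le (integral_nonneg (gibbs_nonneg φ ψ))), ← EReal.coe_sub]

/-- The dual functional is `-∞` where the Gibbs density is not integrable, and it is at least `0`
at the origin, so the Gibbs density of a maximiser is integrable. -/
lemma IsDualMaximiser.integrable_gibbs [IsProbabilityMeasure μ] [IsProbabilityMeasure ν]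
    (hε : 0 < ε) (h : IsDualMaximiser ε μ ν φ ψ) (hφ : Measurable φ) (hψ : Measurable ψ) :
    Integrable (gibbs ε φ ψ) (μ.prod ν) := by
  have h0 : Integrable (gibbs ε (fun _ => 0) (fun _ => 0) : E d × E d → ℝ) (μ.prod ν) := by
    refine (integrable_const (1 : ℝ)).mono'
      (measurable_gibbs measurable_const measurable_const).aestronglyMeasurable
      (ae_of_all _ fun z => ?_)
    rw [Real.norm_of_nonneg (gibbs_nonneg _ _ z), gibbs, Real.exp_le_one_iff]
    exact div_nonpos_of_nonpos_of_nonneg (by linarith [cost_nonneg z.1 z.2]) hε.le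
  have hle := h.2.2 (fun _ => 0) (fun _ => 0) (integrable_zero _ _ _) (integrable_zero _ _ _)
  rw [dualObjective_eq_coe hε h0] at hle
  rw [← lintegral_ofReal_ne_top_iff_integrable
    (measurable_gibbs hφ hψ).aestronglyMeasurable (ae_of_all _ (gibbs_nonneg φ ψ))]
  intro htop
  rw [dualObjective] at hle
  simp only [gibbs] at htop
  rw [htop, ENNReal.mul_top (by simpa using hε), EReal.coe_ennreal_top, EReal.sub_top] at hle
  exact absurd (le_bot_iff.1 hle) (EReal.coe_ne_bot _)

/-- Euler–Lagrange equation of the dual problem in the direction of an indicator: `m` is the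
rate at which the linear part of the functional changes. -/
lemma IsDualMaximiser.setIntegral_gibbs (hε : 0 < ε) (h : IsDualMaximiser ε μ ν φ ψ)
    (hint : Integrable (gibbs ε φ ψ) (μ.prod ν)) {S : Set (E d × E d)} (hS : MeasurableSet S)
    {m : ℝ} (hvar : ∀ t : ℝ, ∃ φ' ψ' : E d → ℝ, Integrable φ' μ ∧ Integrable ψ' ν ∧
      (∫ u, φ' u ∂μ) + (∫ x, ψ' x ∂ν) = (∫ u, φ u ∂μ) + (∫ x, ψ x ∂ν) + t * m ∧
      ∀ z : E d × E d, φ' z.1 + ψ' z.2 = φ z.1 + ψ z.2 + S.indicator (fun _ => t) z) :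
    ∫ z in S, gibbs ε φ ψ z ∂(μ.prod ν) = m := by
  set b := ∫ z in S, gibbs ε φ ψ z ∂(μ.prod ν)
  have key : ∀ t : ℝ, 0 ≤ ε * ((Real.exp (t / ε) - 1) * b) - t * m := by
    intro t
    obtain ⟨φ', ψ', hφ', hψ', hsum, hadd⟩ := hvar t
    have hg : gibbs ε φ' ψ' = fun z =>
        gibbs ε φ ψ z + (Real.exp (t / ε) - 1) * S.indicator (gibbs ε φ ψ) z := by
      funext z
      by_cases hz : z ∈ S
      · rw [Set.indicator_of_mem hz, gibbs, hadd, Set.indicator_of_mem hz, gibbs,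
          show (φ z.1 + ψ z.2 + t - cost z.1 z.2) / ε =
            (φ z.1 + ψ z.2 - cost z.1 z.2) / ε + t / ε by ring, Real.exp_add]
        ring
      · rw [Set.indicator_of_notMem hz, gibbs, hadd, Set.indicator_of_notMem hz, gibbs]
        simp
    have hi : Integrable (fun z => (Real.exp (t / ε) - 1) * S.indicator (gibbs ε φ ψ) z)
        (μ.prod ν) := (hint.indicator hS).const_mul _
    have hle := h.2.2 φ' ψ' hφ' hψ'
    rw [dualObjective_eq_coe hε hint, dualObjective_eq_coe hε (by rw [hg]; exact hint.add hi),
      EReal.coe_le_coe_iff, hsum, hg, integral_add hint hi, integral_const_mul,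
      integral_indicator hS] at hle
    linarith
  have hd : HasDerivAt (fun t : ℝ => ε * ((Real.exp (t / ε) - 1) * b) - t * m) (b - m) 0 := by
    have h1 := (((((hasDerivAt_id (0 : ℝ)).div_const ε).exp.sub_const 1).mul_const b).const_mul
      ε).sub ((hasDerivAt_id (0 : ℝ)).mul_const m)
    convert! h1 using 1
    simp only [id, zero_div, Real.exp_zero]
    field_simp
  have hmin : IsLocalMin (fun t : ℝ => ε * ((Real.exp (t / ε) - 1) * b) - t * m) 0 :=
    Filter.Eventually.of_forall fun t => by simpa using key t
  linarith [hmin.hasDerivAt_eq_zero hd]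

lemma map_ofDensity_eq {Ω Z : Type*} [MeasurableSpace Ω] [MeasurableSpace Z] {P : Measure Ω}
    {p : Ω → ℝ} (hp : Integrable p P) (hp0 : ∀ z, 0 ≤ p z) {f : Ω → Z} (hf : Measurable f)
    {m : Measure Z} [IsFiniteMeasure m]
    (h : ∀ s, MeasurableSet s → ∫ z in f ⁻¹' s, p z ∂P = m.real s) :
    (ofDensity P p).map f = m := by
  ext s hs
  rw [Measure.map_apply hf hs, ofDensity, withDensity_apply _ (hf hs),
    ← ofReal_integral_eq_lintegral_ofReal hp.integrableOn (ae_of_all _ hp0), h s hs,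
    ofReal_measureReal]

/-- A dual maximiser is a pair of Schrödinger potentials, up to the choice of measurable
versions. -/
lemma IsDualMaximiser.exists_isSchrodinger [IsProbabilityMeasure μ] [IsProbabilityMeasure ν]
    (hε : 0 < ε) (h : IsDualMaximiser ε μ ν φ ψ) :
    ∃ φ' ψ', IsSchrodinger ε μ ν φ' ψ' ∧ Integrable φ' μ ∧ Integrable ψ' ν ∧
      φ =ᵐ[μ] φ' ∧ ψ =ᵐ[ν] ψ' := by
  obtain ⟨φ', hφ'm, hφ'⟩ := h.1.aestronglyMeasurable.aemeasurable
  obtain ⟨ψ', hψ'm, hψ'⟩ := h.2.1.aestronglyMeasurable.aemeasurable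
  have hφi : Integrable φ' μ := h.1.congr hφ'
  have hψi : Integrable ψ' ν := h.2.1.congr hψ'
  have h' : IsDualMaximiser ε μ ν φ' ψ' :=
    ⟨hφi, hψi, fun f g hf hg => (h.2.2 f g hf hg).trans_eq (dualObjective_congr hφ' hψ')⟩
  have hint := h'.integrable_gibbs hε hφ'm hψ'm
  refine ⟨φ', ψ', ⟨hφ'm, hψ'm, measurable_gibbs hφ'm hψ'm, gibbs_nonneg _ _, ?_, ?_⟩, hφi, hψi,
    hφ', hψ'⟩
  · refine map_ofDensity_eq hint (gibbs_nonneg _ _) measurable_fst fun s hs =>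
      h'.setIntegral_gibbs hε hint (measurable_fst hs) fun t => ?_
    have hi : Integrable (s.indicator fun _ => t) μ := (integrable_const t).indicator hs
    refine ⟨fun u => φ' u + s.indicator (fun _ => t) u, ψ', hφi.add hi, hψi, ?_, fun z => ?_⟩
    · rw [integral_add hφi hi, integral_indicator hs, setIntegral_const, smul_eq_mul]
      ring
    · change φ' z.1 + s.indicator (fun _ => t) z.1 + ψ' z.2 =
        φ' z.1 + ψ' z.2 + s.indicator (fun _ => t) z.1
      ring
  · refine map_ofDensity_eq hint (gibbs_nonneg _ _) measurable_snd fun s hs =>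
      h'.setIntegral_gibbs hε hint (measurable_snd hs) fun t => ?_
    have hi : Integrable (s.indicator fun _ => t) ν := (integrable_const t).indicator hs
    refine ⟨φ', fun x => ψ' x + s.indicator (fun _ => t) x, hφi, hψi.add hi, ?_, fun z => ?_⟩
    · rw [integral_add hψi hi, integral_indicator hs, setIntegral_const, smul_eq_mul]
      ring
    · change φ' z.1 + (ψ' z.2 + s.indicator (fun _ => t) z.2) =
        φ' z.1 + ψ' z.2 + s.indicator (fun _ => t) z.2
      ring

/-- Integrable Schrödinger potentials are unique up to a constant: `φ ⊕ ψ - φ' ⊕ ψ'` has the same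
integral against both couplings, whereas its sign is that of the difference of their densities. -/
lemma IsSchrodinger.ae_eq_add_const [IsProbabilityMeasure μ] [IsProbabilityMeasure ν] (hε : 0 < ε)
    (h : IsSchrodinger ε μ ν φ ψ) (h' : IsSchrodinger ε μ ν φ' ψ') (hφ : Integrable φ μ)
    (hψ : Integrable ψ ν) (hφ' : Integrable φ' μ) (hψ' : Integrable ψ' ν) :
    ∃ a, ∀ᵐ u ∂μ, φ u = φ' u + a := by
  set f : E d × E d → ℝ := fun z => (φ z.1 - φ' z.1) + (ψ z.2 - ψ' z.2) with hf
  have hi : ∀ p : E d × E d → ℝ, HasMarginals μ ν p → Integrable (fun z => p z * f z) (μ.prod ν) ∧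
      ∫ z, p z * f z ∂(μ.prod ν) = (∫ u, (φ u - φ' u) ∂μ) + ∫ x, (ψ x - ψ' x) ∂ν := by
    intro p hp
    have h1 : Integrable (fun u => φ u - φ' u) ((ofDensity (μ.prod ν) p).map Prod.fst) := by
      rw [hp.map_fst]; exact hφ.sub hφ'
    have h2 : Integrable (fun x => ψ x - ψ' x) ((ofDensity (μ.prod ν) p).map Prod.snd) := by
      rw [hp.map_snd]; exact hψ.sub hψ'
    have e1 := integral_map measurable_fst.aemeasurable h1.aestronglyMeasurable
    have e2 := integral_map measurable_snd.aemeasurable h2.aestronglyMeasurable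
    rw [hp.map_fst] at e1
    rw [hp.map_snd] at e2
    have i1 := h1.comp_measurable measurable_fst
    have i2 := h2.comp_measurable measurable_snd
    refine ⟨(integrable_ofDensity_iff hp.measurable hp.nonneg).1 (i1.add i2), ?_⟩
    have e3 := integral_add i1 i2
    simp only [Function.comp_apply] at e3
    rw [e1, e2, ← e3, integral_ofDensity hp.measurable hp.nonneg]
    simp only [hf, smul_eq_mul]
  obtain ⟨i1, e1⟩ := hi _ h.hasMarginals
  obtain ⟨i2, e2⟩ := hi _ h'.hasMarginals
  have hzero := (integral_eq_zero_iff_of_nonneg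
    (f := fun z => gibbs ε φ ψ z * f z - gibbs ε φ' ψ' z * f z) (fun z => by
      simp only [Pi.zero_apply, ← sub_mul]
      rcases le_total 0 (f z) with hz | hz
      · refine mul_nonneg (sub_nonneg.2 (Real.exp_le_exp.2
          (div_le_div_of_nonneg_right ?_ hε.le))) hz
        simp only [hf] at hz; linarith
      · refine mul_nonneg_of_nonpos_of_nonpos (sub_nonpos.2 (Real.exp_le_exp.2
          (div_le_div_of_nonneg_right ?_ hε.le))) hz
        simp only [hf] at hz; linarith) (i1.sub i2)).1
    (by rw [integral_sub i1 i2, e1, e2, sub_self])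
  have hf0 : ∀ᵐ z ∂(μ.prod ν), f z = 0 := by
    filter_upwards [hzero] with z hz
    simp only [Pi.zero_apply, ← sub_mul] at hz
    rcases mul_eq_zero.1 hz with hz | hz
    · have h1 := Real.exp_injective (sub_eq_zero.1 hz)
      rw [div_left_inj' hε.ne'] at h1
      simp only [hf]; linarith
    · exact hz
  have hae := Measure.ae_ae_of_ae_prod hf0
  -- For almost every `u` the sections at `u` and at `u₀` vanish at a common point `x`.
  obtain ⟨u₀, hu₀⟩ := hae.exists
  refine ⟨φ u₀ - φ' u₀, hae.mono fun u hu => ?_⟩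
  obtain ⟨x, h1, h2⟩ := (hu.and hu₀).exists
  simp only [hf] at h1 h2
  linarith

lemma HasMarginals.ae_lintegral_right [IsProbabilityMeasure μ] [IsProbabilityMeasure ν]
    {p : E d × E d → ℝ} (hp : HasMarginals μ ν p) :
    ∀ᵐ u ∂μ, ∫⁻ x, ENNReal.ofReal (p (u, x)) ∂ν = 1 := by
  have hm := hp.measurable.ennreal_ofReal
  refine ae_eq_of_forall_setLIntegral_eq_of_sigmaFinite hm.lintegral_prod_right'
    measurable_const fun s hs _ => ?_
  have h1 := congrArg (fun m : Measure (E d) => m s) hp.map_fst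
  simp only [Measure.map_apply measurable_fst hs, ofDensity,
    withDensity_apply _ (measurable_fst hs)] at h1
  rw [← Set.prod_univ, setLIntegral_prod _ hm.aemeasurable] at h1
  simpa using h1

lemma HasMarginals.ae_lintegral_left [IsProbabilityMeasure μ] [IsProbabilityMeasure ν]
    {p : E d × E d → ℝ} (hp : HasMarginals μ ν p) :
    ∀ᵐ x ∂ν, ∫⁻ u, ENNReal.ofReal (p (u, x)) ∂μ = 1 := by
  have hm := hp.measurable.ennreal_ofReal
  refine ae_eq_of_forall_setLIntegral_eq_of_sigmaFinite hm.lintegral_prod_left'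
    measurable_const fun s hs _ => ?_
  have h1 := congrArg (fun m : Measure (E d) => m s) hp.map_snd
  simp only [Measure.map_apply measurable_snd hs, ofDensity,
    withDensity_apply _ (measurable_snd hs)] at h1
  rw [← Set.univ_prod, setLIntegral_prod_symm _ hm.aemeasurable] at h1
  simpa using h1

end Schrodinger

/-! ### The first potential determines the measure -/

section Reweighted

variable {d : ℕ} {ε : ℝ} {ν ν₁ ν₂ : Measure (E d)} {φ ψ φ₁ φ₂ ψ₁ ψ₂ : E d → ℝ}

/-- The measure `exp ((ψ(x) - ‖x‖² / 2) / ε) dν(x)`, whose Laplace transform at `u / ε` is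
`exp ((‖u‖² / 2 - φ(u)) / ε)` when `(φ, ψ)` are Schrödinger potentials. -/
noncomputable def reweighted (ε : ℝ) (ν : Measure (E d)) (ψ : E d → ℝ) : Measure (E d) :=
  ofDensity ν fun x => Real.exp ((ψ x - ‖x‖ ^ 2 / 2) / ε)

lemma gibbs_eq_mul (φ ψ : E d → ℝ) (u x : E d) :
    gibbs ε φ ψ (u, x) = Real.exp ((φ u - ‖u‖ ^ 2 / 2) / ε) *
      (Real.exp ((ψ x - ‖x‖ ^ 2 / 2) / ε) * Real.exp ⟪ε⁻¹ • u, x⟫) := by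
  rw [gibbs, ← Real.exp_add, ← Real.exp_add, real_inner_smul_left, cost, norm_sub_sq_real]
  congr 1
  ring

lemma IsSchrodinger.ae_laplace [IsProbabilityMeasure ν]
    (h : IsSchrodinger ε (unifBall d) ν φ ψ) :
    ∀ᵐ u ∂(unifBall d), Integrable (fun x => Real.exp ⟪ε⁻¹ • u, x⟫) (reweighted ε ν ψ) ∧
      laplace (reweighted ε ν ψ) (ε⁻¹ • u) = Real.exp ((‖u‖ ^ 2 / 2 - φ u) / ε) := by
  have hψ := h.measurable_right
  have hw : Measurable fun x : E d => Real.exp ((ψ x - ‖x‖ ^ 2 / 2) / ε) := by fun_prop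
  filter_upwards [h.hasMarginals.ae_lintegral_right] with u hu
  have hmeas : Measurable fun x => gibbs ε φ ψ (u, x) :=
    h.hasMarginals.measurable.comp measurable_prodMk_left
  have hint : Integrable (fun x => gibbs ε φ ψ (u, x)) ν := by
    rw [← lintegral_ofReal_ne_top_iff_integrable hmeas.aestronglyMeasurable
      (ae_of_all _ fun x => gibbs_nonneg φ ψ _), hu]
    exact ENNReal.one_ne_top
  have hone : ∫ x, gibbs ε φ ψ (u, x) ∂ν = 1 := by
    rw [integral_eq_lintegral_of_nonneg_ae (ae_of_all _ fun x => gibbs_nonneg φ ψ _)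
      hmeas.aestronglyMeasurable, hu, ENNReal.toReal_one]
  set a := Real.exp ((φ u - ‖u‖ ^ 2 / 2) / ε) with ha
  have ha0 : a ≠ 0 := (Real.exp_pos _).ne'
  simp only [gibbs_eq_mul φ ψ u] at hint hone
  rw [integral_const_mul] at hone
  constructor
  · rw [reweighted, integrable_ofDensity_iff hw fun x => (Real.exp_pos _).le]
    exact (integrable_const_mul_iff (isUnit_iff_ne_zero.2 ha0) _).1 hint
  · rw [laplace, reweighted, integral_ofDensity hw fun x => (Real.exp_pos _).le]
    simp only [smul_eq_mul]
    rw [eq_inv_of_mul_eq_one_right hone, ← Real.exp_neg]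
    congr 1
    ring

/-- The set where a Laplace transform is finite is convex, so finiteness almost everywhere on a
ball gives finiteness everywhere on it. -/
lemma IsSchrodinger.integrable_exp_smul [IsProbabilityMeasure ν]
    (h : IsSchrodinger ε (unifBall d) ν φ ψ) {u : E d} (hu : u ∈ unitBall d) :
    Integrable (fun x => Real.exp ⟪ε⁻¹ • u, x⟫) (reweighted ε ν ψ) := by
  obtain ⟨v, h1, h2⟩ := exists_add_sub_of_ae (h.ae_laplace.mono fun _ hu => hu.1) hu
  refine (h1.add h2).mono' (by fun_prop) (ae_of_all _ fun x => ?_)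
  rw [Real.norm_eq_abs, Real.abs_exp]
  simp only [Pi.add_apply, smul_add, smul_sub, inner_add_left, inner_sub_left]
  rcases le_total 0 ⟪ε⁻¹ • v, x⟫ with hv | hv
  · exact le_add_of_le_of_nonneg (Real.exp_le_exp.2 (by linarith)) (Real.exp_pos _).le
  · exact le_add_of_nonneg_of_le (Real.exp_pos _).le (Real.exp_le_exp.2 (by linarith))

lemma inv_smul_mem_ball (hε : 0 < ε) {u : E d} (hu : u ∈ unitBall d) :
    ε⁻¹ • u ∈ Metric.ball (0 : E d) ε⁻¹ := by
  have hu' : ‖u‖ < 1 := mem_ball_zero_iff.1 hu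
  rw [mem_ball_zero_iff, norm_smul, Real.norm_of_nonneg (inv_nonneg.2 hε.le)]
  exact mul_lt_of_lt_one_right (inv_pos.2 hε) hu'

lemma exists_eq_inv_smul (hε : 0 < ε) {v : E d} (hv : v ∈ Metric.ball (0 : E d) ε⁻¹) :
    ∃ u ∈ unitBall d, v = ε⁻¹ • u := by
  refine ⟨ε • v, ?_, by rw [smul_smul, inv_mul_cancel₀ hε.ne', one_smul]⟩
  have hv' : ‖v‖ < ε⁻¹ := mem_ball_zero_iff.1 hv
  rw [unitBall, mem_ball_zero_iff, norm_smul, Real.norm_of_nonneg hε.le]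
  calc ε * ‖v‖ < ε * ε⁻¹ := by gcongr
    _ = 1 := mul_inv_cancel₀ hε.ne'

lemma IsSchrodinger.integrable_exp [IsProbabilityMeasure ν] (hε : 0 < ε)
    (h : IsSchrodinger ε (unifBall d) ν φ ψ) :
    ∀ v ∈ Metric.ball (0 : E d) ε⁻¹, Integrable (fun x => Real.exp ⟪v, x⟫) (reweighted ε ν ψ) := by
  intro v hv
  obtain ⟨u, hu, rfl⟩ := exists_eq_inv_smul hε hv
  exact h.integrable_exp_smul hu

lemma IsSchrodinger.reweighted_ne_zero [IsProbabilityMeasure ν]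
    (h : IsSchrodinger ε (unifBall d) ν φ ψ) : reweighted ε ν ψ ≠ 0 := by
  intro h0
  obtain ⟨u, -, hu⟩ := h.ae_laplace.exists
  rw [h0, laplace, integral_zero_measure] at hu
  exact (Real.exp_pos _).ne hu

lemma IsSchrodinger.continuousOn_laplace [IsProbabilityMeasure ν] (hε : 0 < ε)
    (h : IsSchrodinger ε (unifBall d) ν φ ψ) :
    ContinuousOn (fun u => laplace (reweighted ε ν ψ) (ε⁻¹ • u)) (unitBall d) := by
  have h1 : ContinuousOn (laplace (reweighted ε ν ψ)) (Metric.ball 0 ε⁻¹) := fun v hv =>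
    (hasFDerivAt_laplace Metric.isOpen_ball (h.integrable_exp hε)
      hv).continuousAt.continuousWithinAt
  exact h1.comp (by fun_prop) fun u hu => inv_smul_mem_ball hε hu

/-- The logarithmic gradient of the Laplace transform of the reweighted measure; this is the EOT
map of `ν`. -/
noncomputable def logGrad (ε : ℝ) (ν : Measure (E d)) (ψ : E d → ℝ) (u : E d) : E d :=
  (laplace (reweighted ε ν ψ) (ε⁻¹ • u))⁻¹ • laplaceGrad (reweighted ε ν ψ) (ε⁻¹ • u)

lemma IsSchrodinger.continuousOn_logGrad [IsProbabilityMeasure ν] (hε : 0 < ε)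
    (h : IsSchrodinger ε (unifBall d) ν φ ψ) : ContinuousOn (logGrad ε ν ψ) (unitBall d) := by
  refine ContinuousOn.smul ((h.continuousOn_laplace hε).inv₀ fun u hu =>
    (laplace_pos h.reweighted_ne_zero (h.integrable_exp_smul hu)).ne') ?_
  exact (continuousOn_laplaceGrad Metric.isOpen_ball (h.integrable_exp hε)).comp (by fun_prop)
    fun u hu => inv_smul_mem_ball hε hu

/-- The second Schrödinger equation recovers `ν` from the reweighted measure and the first
potential. -/
lemma IsSchrodinger.withDensity_reweighted [IsProbabilityMeasure ν]
    (h : IsSchrodinger ε (unifBall d) ν φ ψ) :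
    (reweighted ε ν ψ).withDensity (fun x => ∫⁻ u, ENNReal.ofReal
      (Real.exp ((φ u - ‖u‖ ^ 2 / 2) / ε) * Real.exp ⟪ε⁻¹ • u, x⟫) ∂(unifBall d)) = ν := by
  have hψ := h.measurable_right
  have hφ := h.measurable_left
  have hH : Measurable fun x => ∫⁻ u, ENNReal.ofReal
      (Real.exp ((φ u - ‖u‖ ^ 2 / 2) / ε) * Real.exp ⟪ε⁻¹ • u, x⟫) ∂(unifBall d) := by
    refine Measurable.lintegral_prod_left' (f := fun z : E d × E d => ENNReal.ofReal
      (Real.exp ((φ z.1 - ‖z.1‖ ^ 2 / 2) / ε) * Real.exp ⟪ε⁻¹ • z.1, z.2⟫)) ?_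
    fun_prop
  rw [reweighted, ofDensity, ← withDensity_mul _ (by fun_prop) hH]
  refine (withDensity_congr_ae (g := 1) ?_).trans withDensity_one
  filter_upwards [h.hasMarginals.ae_lintegral_left] with x hx
  simp only [Pi.mul_apply, Pi.one_apply]
  rw [← lintegral_const_mul' _ _ ENNReal.ofReal_ne_top, ← hx]
  refine lintegral_congr fun u => ?_
  rw [← ENNReal.ofReal_mul (Real.exp_pos _).le, gibbs_eq_mul]
  congr 1
  ring

/-- The first Schrödinger potential determines the measure. -/
lemma IsSchrodinger.measure_eq [IsProbabilityMeasure ν₁] [IsProbabilityMeasure ν₂] (hε : 0 < ε)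
    (h₁ : IsSchrodinger ε (unifBall d) ν₁ φ₁ ψ₁) (h₂ : IsSchrodinger ε (unifBall d) ν₂ φ₂ ψ₂)
    {a : ℝ} (h : ∀ᵐ u ∂(unifBall d), φ₁ u = φ₂ u + a) : ν₁ = ν₂ := by
  -- Moving the constant into the second potential reduces to `a = 0`.
  replace h₂ := h₂.shift a
  have hL : Set.EqOn (fun u => laplace (reweighted ε ν₁ ψ₁) (ε⁻¹ • u))
      (fun u => laplace (reweighted ε ν₂ fun x => ψ₂ x - a) (ε⁻¹ • u)) (unitBall d) := by
    refine eqOn_unitBall_of_ae_eq (h₁.continuousOn_laplace hε) (h₂.continuousOn_laplace hε) ?_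
    filter_upwards [h₁.ae_laplace, h₂.ae_laplace, h] with u hu₁ hu₂ hu
    rw [hu₁.2, hu₂.2, hu]
  have hρ : reweighted ε ν₁ ψ₁ = reweighted ε ν₂ fun x => ψ₂ x - a := by
    refine ext_of_laplace_eqOn (inv_pos.2 hε) (h₁.integrable_exp hε) (h₂.integrable_exp hε) ?_
    intro v hv
    obtain ⟨u, hu, rfl⟩ := exists_eq_inv_smul hε hv
    exact hL hu
  rw [← h₁.withDensity_reweighted, ← h₂.withDensity_reweighted, hρ]
  congr 1
  funext x
  refine lintegral_congr_ae ?_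
  filter_upwards [h] with u hu
  rw [hu]

end Reweighted

/-! ### EOT maps -/

section Maps

variable {d : ℕ} {ε : ℝ} {ν ν₁ ν₂ : Measure (E d)} {φ ψ φ₁ φ₂ ψ₁ ψ₂ : E d → ℝ}

/-- The EOT map is the logarithmic gradient of the Laplace transform of the reweighted measure. -/
lemma IsSchrodinger.ae_eq_logGrad [IsProbabilityMeasure ν] (hν : MemLp id 2 ν)
    (h : IsSchrodinger ε (unifBall d) ν φ ψ) {T : E d → E d}
    (hT : AEStronglyMeasurable T (unifBall d))
    (hce : (fun p : E d × E d => T p.1)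
      =ᵐ[ofDensity ((unifBall d).prod ν) (gibbs ε φ ψ)]
        condExp (MeasurableSpace.comap (Prod.fst : E d × E d → E d) inferInstance)
          (ofDensity ((unifBall d).prod ν) (gibbs ε φ ψ)) (Prod.snd : E d × E d → E d)) :
    T =ᵐ[unifBall d] logGrad ε ν ψ := by
  have hψ := h.measurable_right
  have hG := h.hasMarginals
  have := hG.isProbabilityMeasure
  set π := ofDensity ((unifBall d).prod ν) (gibbs ε φ ψ) with hπ
  have hsnd : Integrable (Prod.snd : E d × E d → E d) π := by
    have h1 : Integrable id (π.map Prod.snd) := by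
      rw [hπ, hG.map_snd]; exact hν.integrable (by norm_num)
    exact h1.comp_measurable measurable_snd
  have hTπ : Integrable (fun p : E d × E d => T p.1) π := integrable_condExp.congr hce.symm
  have hTm : AEStronglyMeasurable T (π.map Prod.fst) := by rw [hπ, hG.map_fst]; exact hT
  have hTi : Integrable T (unifBall d) := by
    have := (integrable_map_measure hTm measurable_fst.aemeasurable).2 hTπ
    rwa [hπ, hG.map_fst] at this
  have hgs : Integrable (fun z : E d × E d => gibbs ε φ ψ z • z.2) ((unifBall d).prod ν) :=
    (integrable_ofDensity_iff hG.measurable hG.nonneg).1 hsnd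
  have hN : T =ᵐ[unifBall d] fun u => ∫ x, gibbs ε φ ψ (u, x) • x ∂ν := by
    refine Integrable.ae_eq_of_forall_setIntegral_eq _ _ hTi hgs.integral_prod_left
      fun s hs _ => ?_
    have e1 : ∫ u in s, T u ∂(unifBall d) = ∫ p in Prod.fst ⁻¹' s, T p.1 ∂π := by
      rw [← setIntegral_map hs hTm measurable_fst.aemeasurable, hπ, hG.map_fst]
    have e2 : ∫ p in Prod.fst ⁻¹' s, T p.1 ∂π = ∫ p in Prod.fst ⁻¹' s, p.2 ∂π := by
      rw [setIntegral_congr_ae (measurable_fst hs) (hce.mono fun p hp _ => hp)]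
      exact setIntegral_condExp measurable_fst.comap_le hsnd ⟨s, hs, rfl⟩
    rw [e1, e2, hπ, ofDensity, setIntegral_withDensity_eq_setIntegral_toReal_smul
      hG.measurable.ennreal_ofReal (ae_of_all _ fun _ => ENNReal.ofReal_lt_top) _
      (measurable_fst hs)]
    simp only [ENNReal.toReal_ofReal (gibbs_nonneg φ ψ _)]
    rw [← Set.prod_univ, setIntegral_prod _ hgs.integrableOn]
    simp
  filter_upwards [hN, h.ae_laplace] with u hu hL
  rw [hu, logGrad, hL.2, laplaceGrad, reweighted,
    integral_ofDensity (by fun_prop) fun x => (Real.exp_pos _).le, ← integral_smul]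
  refine integral_congr_ae (ae_of_all _ fun x => ?_)
  simp only [smul_smul]
  rw [gibbs_eq_mul, ← Real.exp_neg]
  congr 3
  ring

/-- The EOT map determines the measure. -/
lemma IsEOTMap.measure_eq [IsProbabilityMeasure ν₁] [IsProbabilityMeasure ν₂] (hε : 0 < ε)
    (hν₁ : MemLp id 2 ν₁) (hν₂ : MemLp id 2 ν₂) {T₁ T₂ : E d → E d} (h₁ : IsEOTMap ε ν₁ T₁)
    (h₂ : IsEOTMap ε ν₂ T₂) (h : T₁ =ᵐ[unifBall d] T₂) : ν₁ = ν₂ := by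
  obtain ⟨hT₁, π₁, hπ₁, hc₁⟩ := h₁
  obtain ⟨hT₂, π₂, hπ₂, hc₂⟩ := h₂
  obtain ⟨φ₁, ψ₁, hS₁, rfl⟩ := hπ₁.exists_isSchrodinger hε memLp_id_unifBall hν₁
  obtain ⟨φ₂, ψ₂, hS₂, rfl⟩ := hπ₂.exists_isSchrodinger hε memLp_id_unifBall hν₂
  have hg := eqOn_unitBall_of_ae_eq (hS₁.continuousOn_logGrad hε) (hS₂.continuousOn_logGrad hε)
    ((hS₁.ae_eq_logGrad hν₁ hT₁ hc₁).symm.trans (h.trans (hS₂.ae_eq_logGrad hν₂ hT₂ hc₂)))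
  obtain ⟨C, hC, hL⟩ := exists_laplace_eq_mul hS₁.reweighted_ne_zero hS₂.reweighted_ne_zero
    Metric.isOpen_ball (convex_ball (0 : E d) ε⁻¹).isPreconnected (hS₁.integrable_exp hε)
    (hS₂.integrable_exp hε) fun v hv => by
      obtain ⟨u, hu, rfl⟩ := exists_eq_inv_smul hε hv
      exact hg hu
  refine hS₁.measure_eq hε hS₂ (a := -(ε * Real.log C)) ?_
  filter_upwards [hS₁.ae_laplace, hS₂.ae_laplace, ae_unifBall_mem] with u hu₁ hu₂ hu
  have := hL _ (inv_smul_mem_ball hε hu)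
  rw [hu₁.2, hu₂.2, ← Real.exp_log hC, ← Real.exp_add] at this
  have := Real.exp_injective this
  field_simp at this
  linarith

lemma IsEOTMap.ae_eq [IsProbabilityMeasure ν] (hε : 0 < ε) (hν : MemLp id 2 ν)
    {T₁ T₂ : E d → E d} (h₁ : IsEOTMap ε ν T₁) (h₂ : IsEOTMap ε ν T₂) : T₁ =ᵐ[unifBall d] T₂ := by
  obtain ⟨hT₁, π₁, hπ₁, hc₁⟩ := h₁
  obtain ⟨hT₂, π₂, hπ₂, hc₂⟩ := h₂
  obtain rfl := hπ₁.eq hε memLp_id_unifBall hν hπ₂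
  obtain ⟨φ, ψ, hS, rfl⟩ := hπ₁.exists_isSchrodinger hε memLp_id_unifBall hν
  exact (hS.ae_eq_logGrad hν hT₁ hc₁).trans (hS.ae_eq_logGrad hν hT₂ hc₂).symm

end Maps

/-! ### EOT potentials -/

section Potentials

variable {d : ℕ} {ε : ℝ} {ν ν₁ ν₂ : Measure (E d)} {φ ψ φ₁ φ₂ ψ₁ ψ₂ : E d → ℝ}

lemma IsDualMaximiser.measure_eq [IsProbabilityMeasure ν₁] [IsProbabilityMeasure ν₂] (hε : 0 < ε)
    (h₁ : IsDualMaximiser ε (unifBall d) ν₁ φ₁ ψ₁) (h₂ : IsDualMaximiser ε (unifBall d) ν₂ φ₂ ψ₂)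
    {a : ℝ} (h : ∀ᵐ u ∂(unifBall d), φ₁ u = φ₂ u + a) : ν₁ = ν₂ := by
  obtain ⟨φ₁', ψ₁', hS₁, -, -, he₁, -⟩ := h₁.exists_isSchrodinger hε
  obtain ⟨φ₂', ψ₂', hS₂, -, -, he₂, -⟩ := h₂.exists_isSchrodinger hε
  refine hS₁.measure_eq hε hS₂ (a := a) ?_
  filter_upwards [h, he₁, he₂] with u h h1 h2
  rw [← h1, ← h2, h]

/-- The EOT potential determines the measure, whatever the base points are. -/
lemma IsEOTPotential.measure_eq [IsProbabilityMeasure ν₁] [IsProbabilityMeasure ν₂] (hε : 0 < ε)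
    {u₁ u₂ : E d} {f₁ f₂ : E d → ℝ} (h₁ : IsEOTPotential ε ν₁ u₁ f₁)
    (h₂ : IsEOTPotential ε ν₂ u₂ f₂) (h : ∀ᵐ u ∂(unifBall d), f₁ u = f₂ u) : ν₁ = ν₂ := by
  obtain ⟨φ₁, ψ₁, hm₁, -, hf₁⟩ := h₁
  obtain ⟨φ₂, ψ₂, hm₂, -, hf₂⟩ := h₂
  refine hm₁.measure_eq hε hm₂
    (a := ‖u₂‖ ^ 2 / 2 - φ₂ u₂ - (‖u₁‖ ^ 2 / 2 - φ₁ u₁)) ?_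
  filter_upwards [h, ae_unifBall_mem] with u h hu
  rw [hf₁ u hu, hf₂ u hu] at h
  linarith

/-- Two EOT potentials of the same measure differ by a constant on the whole ball, since the
continuous representatives of the dual maximisers do. -/
lemma IsEOTPotential.exists_eq_add [IsProbabilityMeasure ν] (hε : 0 < ε)
    {u₁ u₂ : E d} {f₁ f₂ : E d → ℝ} (h₁ : IsEOTPotential ε ν u₁ f₁)
    (h₂ : IsEOTPotential ε ν u₂ f₂) : ∃ a, ∀ u ∈ unitBall d, f₁ u = f₂ u + a := by
  obtain ⟨φ₁, ψ₁, hm₁, hc₁, hf₁⟩ := h₁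
  obtain ⟨φ₂, ψ₂, hm₂, hc₂, hf₂⟩ := h₂
  obtain ⟨φ₁', ψ₁', hS₁, hφ₁, hψ₁, he₁, -⟩ := hm₁.exists_isSchrodinger hε
  obtain ⟨φ₂', ψ₂', hS₂, hφ₂, hψ₂, he₂, -⟩ := hm₂.exists_isSchrodinger hε
  obtain ⟨b, hb⟩ := hS₁.ae_eq_add_const hε hS₂ hφ₁ hψ₁ hφ₂ hψ₂
  have heq : Set.EqOn φ₁ (fun u => φ₂ u + b) (unitBall d) := by
    refine eqOn_unitBall_of_ae_eq hc₁ (hc₂.add continuousOn_const) ?_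
    filter_upwards [hb, he₁, he₂] with u hb h1 h2
    rw [h1, h2, hb]
  refine ⟨‖u₂‖ ^ 2 / 2 - φ₂ u₂ - (‖u₁‖ ^ 2 / 2 - φ₁ u₁) - b, fun u hu => ?_⟩
  rw [hf₁ u hu, hf₂ u hu, show φ₁ u = φ₂ u + b from heq hu]
  ring

lemma IsEOTPotential.apply_basePoint {u₀ : E d} {f : E d → ℝ} (h : IsEOTPotential ε ν u₀ f)
    (hu₀ : u₀ ∈ unitBall d) : f u₀ = 0 := by
  obtain ⟨φ, ψ, -, -, hf⟩ := h
  rw [hf u₀ hu₀, sub_self]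

lemma IsEOTPotential.eqOn [IsProbabilityMeasure ν] (hε : 0 < ε) {u₀ : E d} {f₁ f₂ : E d → ℝ}
    (h₁ : IsEOTPotential ε ν u₀ f₁) (h₂ : IsEOTPotential ε ν u₀ f₂) (hu₀ : u₀ ∈ unitBall d) :
    Set.EqOn f₁ f₂ (unitBall d) := by
  obtain ⟨a, ha⟩ := h₁.exists_eq_add hε h₂
  have h0 := ha u₀ hu₀
  rw [h₁.apply_basePoint hu₀, h₂.apply_basePoint hu₀] at h0
  intro u hu
  rw [ha u hu]
  linarith

lemma IsEOTPotential.eqOn_of_isMinBasePoint [IsProbabilityMeasure ν] (hε : 0 < ε)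
    {u₀ u₁ u₂ : E d} {f₁ f₂ : E d → ℝ} (h₁ : IsEOTPotential ε ν u₁ f₁)
    (h₂ : IsEOTPotential ε ν u₂ f₂) (hb₁ : IsMinBasePoint u₀ f₁ u₁)
    (hb₂ : IsMinBasePoint u₀ f₂ u₂) : Set.EqOn f₁ f₂ (unitBall d) := by
  obtain ⟨a, ha⟩ := h₁.exists_eq_add hε h₂
  have h0₁ := h₁.apply_basePoint hb₁.1
  have h0₂ := h₂.apply_basePoint hb₂.1
  have e₁ := ha u₁ hb₁.1
  have e₂ := ha u₂ hb₂.1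
  -- A minimiser of one potential is a minimiser of the other.
  have m₁ : ∀ v, IsMinOn f₁ (unitBall d) v → v ∈ unitBall d → IsMinOn f₂ (unitBall d) v :=
    fun v hv hvm => isMinOn_iff.2 fun w hw => by
      linarith [isMinOn_iff.1 hv w hw, ha w hw, ha v hvm]
  have m₂ : ∀ v, IsMinOn f₂ (unitBall d) v → v ∈ unitBall d → IsMinOn f₁ (unitBall d) v :=
    fun v hv hvm => isMinOn_iff.2 fun w hw => by
      linarith [isMinOn_iff.1 hv w hw, ha w hw, ha v hvm]
  have ha0 : a = 0 := by
    rcases hb₁.2 with hm₁ | ⟨hn₁, hu₁⟩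
    · rcases hb₂.2 with hm₂ | ⟨hn₂, -⟩
      · have i₁ := isMinOn_iff.1 hm₁ u₂ hb₂.1
        have i₂ := isMinOn_iff.1 hm₂ u₁ hb₁.1
        linarith
      · exact absurd ⟨u₁, hb₁.1, m₁ u₁ hm₁ hb₁.1⟩ hn₂
    · rcases hb₂.2 with hm₂ | ⟨-, hu₂⟩
      · exact absurd ⟨u₂, hb₂.1, m₂ u₂ hm₂ hb₂.1⟩ hn₁
      · rw [hu₁, ← hu₂] at e₁ h0₁
        linarith
  intro u hu
  rw [ha u hu, ha0, add_zero]

end Potentials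

end EOT

theorem mainTheorem2 (d : ℕ) (ε : ℝ) (hε : 0 < ε)
    (ν₁ ν₂ : Measure (EOT.E d)) [IsProbabilityMeasure ν₁] [IsProbabilityMeasure ν₂]
    (hν₁ : MemLp id 2 ν₁) (hν₂ : MemLp id 2 ν₂) :
    -- potentials with a common fixed base point
    (∀ u₀ ∈ EOT.unitBall d, ∀ f₁ f₂ : EOT.E d → ℝ,
      EOT.IsEOTPotential ε ν₁ u₀ f₁ → EOT.IsEOTPotential ε ν₂ u₀ f₂ →
        (ν₁ = ν₂ ↔ ∀ᵐ u ∂(EOT.unifBall d), f₁ u = f₂ u)) ∧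
    -- potentials whose base points are minimisers whenever minimisers exist
    (∀ u₀ ∈ EOT.unitBall d, ∀ (u₁ u₂ : EOT.E d) (f₁ f₂ : EOT.E d → ℝ),
      EOT.IsEOTPotential ε ν₁ u₁ f₁ → EOT.IsEOTPotential ε ν₂ u₂ f₂ →
      EOT.IsMinBasePoint u₀ f₁ u₁ → EOT.IsMinBasePoint u₀ f₂ u₂ →
        (ν₁ = ν₂ ↔ ∀ᵐ u ∂(EOT.unifBall d), f₁ u = f₂ u)) ∧
    -- maps
    (∀ T₁ T₂ : EOT.E d → EOT.E d, EOT.IsEOTMap ε ν₁ T₁ → EOT.IsEOTMap ε ν₂ T₂ →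
      (ν₁ = ν₂ ↔ ∀ᵐ u ∂(EOT.unifBall d), T₁ u = T₂ u)) := by
  refine ⟨fun u₀ hu₀ f₁ f₂ h₁ h₂ => ⟨?_, h₁.measure_eq hε h₂⟩,
    fun u₀ _ u₁ u₂ f₁ f₂ h₁ h₂ hb₁ hb₂ => ⟨?_, h₁.measure_eq hε h₂⟩,
    fun T₁ T₂ h₁ h₂ => ⟨?_, h₁.measure_eq hε hν₁ hν₂ h₂⟩⟩
  · rintro rfl
    exact EOT.ae_unifBall_mem.mono (h₁.eqOn hε h₂ hu₀)
  · rintro rfl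
    exact EOT.ae_unifBall_mem.mono (h₁.eqOn_of_isMinBasePoint hε h₂ hb₁ hb₂)
  · rintro rfl
    exact h₁.ae_eq hε hν₁ h₂
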